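/- **Setting.** Consider a fully cooperative Markov game with $N$ agents, finite state space $\mathcal S$, common finite action space $\mathcal A$, transition kernel $\mathcal P$, reward $r:\mathcal S\times\mathcal A^N\to[0,1]$ and discount $\gamma\in[0,1)$. A joint policy is written in factorized form $\boldsymbol\pi(\mathbf a|s)=\prod_{m=1}^N\pi^m(a^m|s,\mathbf a^{1:m-1})$, and $\boldsymbol\pi^{1:m}$ denotes the product of its first $m$ factors. $V_{\boldsymbol\pi}$, $Q_{\boldsymbol\pi}$ are the usual discounted value functions and $Q^{1:m}_{\boldsymbol\pi}(s,\mathbf a^{1:m})$ is the expectation of $Q_{\boldsymbol\pi}(s,\mathbf a)$ when the actions of agents $m+1,\dots,N$ follow $\boldsymbol\pi$. Let $\boldsymbol\pi_*$ be an optimal joint policy with stationary state distribution $\nu_*$, and $J(\boldsymbol\pi)=\mathbb E_{s\sim\nu_*}V_{\boldsymbol\pi}(s)$. Let $\phi(s,\mathbf a^{1:m-1},a^m)\in\mathbb R^d$ be feature vectors with $\|\phi\|_2\le1$, let $\Theta=\{\theta\in\mathbb R^d:\|\theta\|_2\le R\}$ with $R>0$, and let $\pi_{\theta^m}(a^m|s,\mathbf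 a^{1:m-1})\propto\exp(\phi(s,\mathbf a^{1:m-1},a^m)^\top\theta^m)$. **Algorithm (multi-agent PPO).** Inputs: $\beta>0$, $G>0$, $K,T\ge1$. Put $\eta=R/(G\sqrt T)$, $\beta_k=\beta\sqrt K$ and $\theta_0^m=0$. For $k=0,\dots,K-1$ let $\nu_k$ be a stationary state distribution of $\boldsymbol\pi_{\theta_k}$. For each agent $m$ obtain an estimate $\hat Q_k^{1:m}$ of $Q^{1:m}_{\boldsymbol\pi_{\theta_k}}$, draw $T$ independent samples $(s,\mathbf a^{1:m-1},a^m)\sim\sigma_k=\nu_k\boldsymbol\pi_{\theta_k}$, independent of $\hat Q_k^{1:m}$ given the past, and run projected SGD: $\theta(0)=0$ and $$\theta(t+1)=\Pi_\Theta\Big(\theta(t)-2\eta\,\phi\,\big((\theta(t)-\theta_k^m)^\top\phi-\beta_k^{-1}\hat Q_k^{1:m}\big)\Big),\qquad 0\le t<T,$$ with $\phi$ and $\hat Q_k^{1:m}$ evaluated at the $t$-th sample. Set $\theta_{k+1}^m=\frac1T\sum_{t=1}^T\theta(t)$. The output is $\bar{\boldsymbol\pi}=\boldsymbol\pi_{\theta_k}$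 with $k$ uniform on $\{0,\dots,K-1\}$. **Assumptions and error terms.** For all $k<K$ and all $m$, assume $|\hat Q_k^{1:m}|\le B$ with $B>0$, and $\big[\mathbb E_{\sigma_k}(\hat Q_k^{1:m}-Q^{1:m}_{\boldsymbol\pi_{\theta_k}})^2\big]^{1/2}\le\xi_k^m$. Assume $\nu_*\ll\nu_k$, so that the concentrability coefficients $$\phi_k^m=\Big\|\tfrac{d(\nu_*\boldsymbol\pi_*^{1:m})}{d(\nu_k\boldsymbol\pi_{\theta_k}^{1:m})}\Big\|_{2,\sigma_k},\qquad 0\le m\le N,$$ are defined. Put $L_k^m(\theta)=\mathbb E_{\sigma_k}\big((\theta-\theta_k^m)^\top\phi-\beta_k^{-1}\hat Q_k^{1:m}\big)^2$. For numbers $\epsilon_k^m\ge0$ put $\Delta_k^m=\sqrt2(\phi_k^m+\phi_k^{m-1})(\epsilon_k^m+\xi_k^m/\beta_k)$, $\delta_k^m=2\phi_k^{m-1}\epsilon_k^m$ and $D=N\log|\mathcal A|+\sum_{m=1}^N\sum_{k=0}^{K-1}(\Delta_k^m+\delta_k^m)$. **Theorem.** There is a constant $C$ depending only on $R$ such that the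 following holds. 1. (Single executions.) If, in an execution of the algorithm, $L_k^m(\theta_{k+1}^m)\le(\epsilon_k^m)^2$ for all $k<K$ and all $m$, and $\beta=\sqrt{\frac{NB^2/2}{D}}$, then, with the expectation over the uniform index $k$, $$J(\boldsymbol\pi_*)-\mathbb E\,J(\bar{\boldsymbol\pi})\le C\,\frac{B\sqrt N}{1-\gamma}\sqrt{\frac DK}.$$ 2. (In expectation over the samples.) Suppose instead that $(\epsilon_k^m)^2$ bounds almost surely the expectation of $L_k^m(\theta_{k+1}^m)$ over the $T$ samples of the inner loop, given everything before them. Here $\epsilon_k^m$ and $\xi_k^m$ may be random. Suppose $\sum_{m,k}(\Delta_k^m+\delta_k^m)$ is integrable, and replace it by its expectation in $D$. If $\beta=\sqrt{\frac{NB^2/2}{D}}$, then the same bound holds with the expectation taken over the samples, the estimates and $k$. 3. (Inner-loop error.) Let $\epsilon_{approx}=\sqrt{\min_{\theta\in\Theta}L_k^m(\theta)}$, and let $(\epsilon_k^m)^2$ be equal to the conditional expectation of $L_k^m(\theta_{k+1}^m)$ in 2. Then for every execution with $|\hat Q_k^{1:m}|\le B$ (for any $\beta>0$), $$\epsilon_{approx}\le\epsilon_k^m\le\epsilon_{approx}+C'\,T^{-1/4},$$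 where $C'$ depends only on $R$, $G$ and an upper bound for $B/\beta_k$. -/

import Mathlib

open MeasureTheory

universe u v w

noncomputable section

namespace MAPPO

/-- A fully cooperative Markov game with `N` agents, finite state space `S`, a common finite action
space `A`, transition kernel `P`, reward `r` with values in `[0, 1]` and discount `γ ∈ [0, 1)`. -/
structure MarkovGame (N : ℕ) (S A : Type*) [Fintype S] where
  P : S → (Fin N → A) → S → ℝ
  P_nonneg : ∀ s a s', 0 ≤ P s a s'
  P_sum : ∀ s a, ∑ s', P s a s' = 1
  r : S → (Fin N → A) → ℝ
  r_nonneg : ∀ s a, 0 ≤ r s a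
  r_le_one : ∀ s a, r s a ≤ 1
  γ : ℝ
  γ_nonneg : 0 ≤ γ
  γ_lt_one : γ < 1

/-- The first `j` entries of a tuple of actions. -/
def pre {A : Type*} {n : ℕ} (a : Fin n → A) (j : ℕ) (hj : j ≤ n) : Fin j → A :=
  fun i => a (Fin.castLE hj i)

/-- A joint policy in factorized form: `prob m s b a` is the probability that agent `m` (agents are
numbered from `0`) takes action `a` in state `s` when the agents before it take the actions `b`.
Every joint policy `S → Δ(A^N)` factorizes in this way. -/
structure JointPolicy (N : ℕ) (S A : Type*) [Fintype A] where
  prob : (m : Fin N) → S → (Fin m → A) → A → ℝ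
  prob_nonneg : ∀ m s b a, 0 ≤ prob m s b a
  prob_sum : ∀ m s b, ∑ a, prob m s b a = 1

section Policies

variable {N : ℕ} {S A : Type*} [Fintype A]

/-- The probability that the first `j` agents take the actions `b` in state `s`. -/
def JointPolicy.prefixProb (π : JointPolicy N S A) (j : ℕ) (hj : j ≤ N) (s : S)
    (b : Fin j → A) : ℝ :=
  ∏ i : Fin j, π.prob (Fin.castLE hj i) s (pre b i i.isLt.le) (b i)

/-- The probability of the joint action `a` in state `s`. -/
def JointPolicy.joint (π : JointPolicy N S A) (s : S) (a : Fin N → A) : ℝ :=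
  π.prefixProb N le_rfl s a

/-- The probability, given the first `j` entries of `a`, that the remaining agents act as in `a`. -/
def JointPolicy.tailProb (π : JointPolicy N S A) (j : ℕ) (s : S) (a : Fin N → A) : ℝ :=
  ∏ i : Fin N, if j ≤ (i : ℕ) then π.prob i s (pre a i i.isLt.le) (a i) else 1

end Policies

section Values

variable {N : ℕ} {S A : Type*} [Fintype S] [DecidableEq S] [Fintype A] [DecidableEq A]

/-- The law of `(s_t, a_t)` under the policy `π` when `(s_0, a_0)` has law `init`. -/
def saDist (M : MarkovGame N S A) (π : JointPolicy N S A) (init : S → (Fin N → A) → ℝ) :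
    ℕ → S → (Fin N → A) → ℝ
  | 0 => init
  | t + 1 => fun s' a' =>
      (∑ s, ∑ a, saDist M π init t s a * M.P s a s') * π.joint s' a'

/-- The expected discounted return when `(s_0, a_0)` has law `init`. -/
def discReturn (M : MarkovGame N S A) (π : JointPolicy N S A) (init : S → (Fin N → A) → ℝ) : ℝ :=
  ∑' t : ℕ, M.γ ^ t * ∑ s, ∑ a, saDist M π init t s a * M.r s a

/-- The value function `V_π(s)`. -/
def V (M : MarkovGame N S A) (π : JointPolicy N S A) (s : S) : ℝ :=
  discReturn M π (fun s₀ a₀ => if s₀ = s then π.joint s a₀ else 0)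

/-- The action value function `Q_π(s, a)`. -/
def Q (M : MarkovGame N S A) (π : JointPolicy N S A) (s : S) (a : Fin N → A) : ℝ :=
  discReturn M π (fun s₀ a₀ => if s₀ = s ∧ a₀ = a then 1 else 0)

/-- The multi-agent action value function of the first `j` agents: the actions `b` of these agents
are given, and the other agents follow `π`. -/
def Qpre (M : MarkovGame N S A) (π : JointPolicy N S A) (j : ℕ) (hj : j ≤ N) (s : S)
    (b : Fin j → A) : ℝ :=
  ∑ a : Fin N → A, if pre a j hj = b then π.tailProb j s a * Q M π s a else 0

/-- `ν` is a stationary state distribution of the policy `π`. -/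
structure IsStationary (M : MarkovGame N S A) (π : JointPolicy N S A) (ν : S → ℝ) : Prop where
  nonneg : ∀ s, 0 ≤ ν s
  sum_eq_one : ∑ s, ν s = 1
  invariant : ∀ s', ∑ s, ∑ a, ν s * π.joint s a * M.P s a s' = ν s'

/-- `π` is an optimal joint policy. -/
def IsOptimal (M : MarkovGame N S A) (π : JointPolicy N S A) : Prop :=
  ∀ (π' : JointPolicy N S A) (s : S), V M π' s ≤ V M π s

/-- The objective `J(π) = E_{s ∼ ν} V_π(s)`. -/
def J (M : MarkovGame N S A) (ν : S → ℝ) (π : JointPolicy N S A) : ℝ :=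
  ∑ s, ν s * V M π s

/-- The concentrability coefficient of the first `j` agents: the `L²(ν π^{1:j})`-norm of the density
of `ν' π'^{1:j}` with respect to `ν π^{1:j}` (meaningful if the former is absolutely continuous with
respect to the latter). -/
def conc (ν' : S → ℝ) (π' : JointPolicy N S A) (ν : S → ℝ) (π : JointPolicy N S A)
    (j : ℕ) (hj : j ≤ N) : ℝ :=
  √(∑ s, ∑ b : Fin j → A, (ν s * π.prefixProb j hj s b) *
      ((ν' s * π'.prefixProb j hj s b) / (ν s * π.prefixProb j hj s b)) ^ 2)

end Values

/-- A sample `(s, a^{1:m-1}, a^m)` used by agent `m`. -/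
abbrev Sample {N : ℕ} (S A : Type*) (m : Fin N) : Type _ := S × (Fin m → A) × A

/-- The law of a sample of agent `m` when the state has law `ν` and the agents follow `π`. -/
def sampleProb {N : ℕ} {S A : Type*} [Fintype A] (ν : S → ℝ) (π : JointPolicy N S A) (m : Fin N)
    (x : Sample S A m) : ℝ :=
  ν x.1 * π.prefixProb m m.isLt.le x.1 x.2.1 * π.prob m x.1 x.2.1 x.2.2

/-- Feature vectors `φ(s, a^{1:m-1}, a^m) ∈ ℝ^d` for every agent `m`. -/
abbrev Features (N : ℕ) (S A : Type*) (d : ℕ) : Type _ :=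
  (m : Fin N) → Sample S A m → EuclideanSpace ℝ (Fin d)

/-- The joint policy made of the log-linear conditional policies with parameters `θ`. -/
def logLinear {N d : ℕ} {S A : Type*} [Fintype A] [Nonempty A] (φ : Features N S A d)
    (θ : Fin N → EuclideanSpace ℝ (Fin d)) : JointPolicy N S A where
  prob m s b a :=
    Real.exp (inner ℝ (φ m (s, b, a)) (θ m)) / ∑ a', Real.exp (inner ℝ (φ m (s, b, a')) (θ m))
  prob_nonneg _ _ _ _ := by positivity
  prob_sum m s b := by
    rw [← Finset.sum_div]
    exact div_self (Finset.sum_pos (fun _ _ => Real.exp_pos _) Finset.univ_nonempty).ne'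

section Solver

variable {E : Type*} [NormedAddCommGroup E] [InnerProductSpace ℝ E]

/-- The metric projection onto the closed ball `Θ` of radius `R` around `0`. -/
def projBall (R : ℝ) (v : E) : E := if ‖v‖ ≤ R then v else (R / ‖v‖) • v

/-- The iterates `θ(0) = 0, θ(1), …, θ(T)` of the projected SGD solver with stepsize `η`, for
features `f`, current parameter `θk`, targets `q / βk` and samples `x`. -/
def sgdIter {X : Type*} {T : ℕ} (R η βk : ℝ) (f : X → E) (q : X → ℝ) (θk : E) (x : Fin T → X) :
    ℕ → E
  | 0 => 0
  | t + 1 =>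
      let θ := sgdIter R η βk f q θk x t
      if h : t < T then
        projBall R (θ - (2 * η * (inner ℝ (θ - θk) (f (x ⟨t, h⟩)) - q (x ⟨t, h⟩) / βk)) •
          f (x ⟨t, h⟩))
      else θ

/-- The output of the solver, the average of `θ(1), …, θ(T)`. -/
def sgdOut {X : Type*} {T : ℕ} (R η βk : ℝ) (f : X → E) (q : X → ℝ) (θk : E) (x : Fin T → X) : E :=
  (T : ℝ)⁻¹ • ∑ t ∈ Finset.Icc 1 T, sgdIter R η βk f q θk x t

end Solver

/-- The data of one execution of the algorithm: parameters `θ_k^m`, estimates `Q̂_k^{1:m}`,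
stationary state distributions `ν_k` and samples, for each outer iteration `k` and agent `m`. -/
structure Path (N : ℕ) (S A : Type*) (d T : ℕ) where
  θ : ℕ → Fin N → EuclideanSpace ℝ (Fin d)
  Qhat : ℕ → (m : Fin N) → Sample S A m → ℝ
  ν : ℕ → S → ℝ
  X : ℕ → (m : Fin N) → Fin T → Sample S A m

/-- The parameter `β_k = β √K`. -/
def betaK (β : ℝ) (K : ℕ) : ℝ := β * √(K : ℝ)

/-- The stepsize `η = R / (G √T)`. -/
def stepSize (R G : ℝ) (T : ℕ) : ℝ := R / (G * √(T : ℝ))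

section Algorithm

variable {N d T : ℕ} {S A : Type*} [Fintype S] [DecidableEq S] [Fintype A] [DecidableEq A]
  [Nonempty A]

/-- The policy `π_{θ_k}`. -/
def Path.policy (p : Path N S A d T) (φ : Features N S A d) (k : ℕ) : JointPolicy N S A :=
  logLinear φ (p.θ k)

/-- The law `σ_k` of the samples of agent `m` in iteration `k`. -/
def Path.sigma (p : Path N S A d T) (φ : Features N S A d) (k : ℕ) (m : Fin N)
    (x : Sample S A m) : ℝ :=
  sampleProb (p.ν k) (p.policy φ k) m x

/-- The result of the inner solver of agent `m` in iteration `k` on the samples `x`. -/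
def Path.solve (p : Path N S A d T) (φ : Features N S A d) (R G βk : ℝ) (k : ℕ) (m : Fin N)
    (x : Fin T → Sample S A m) : EuclideanSpace ℝ (Fin d) :=
  sgdOut R (stepSize R G T) βk (φ m) (p.Qhat k m) (p.θ k m) x

/-- The path `p` is an execution of `K` iterations of the algorithm. -/
structure IsExecution (M : MarkovGame N S A) (φ : Features N S A d) (R G β : ℝ) (K : ℕ)
    (p : Path N S A d T) : Prop where
  init : ∀ m, p.θ 0 m = 0
  stationary : ∀ k < K, IsStationary M (p.policy φ k) (p.ν k)
  update : ∀ k < K, ∀ m, p.θ (k + 1) m = p.solve φ R G (betaK β K) k m (p.X k m)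

/-- The mean squared error `L(θ)` of the sub-problem of agent `m` in iteration `k`. -/
def Path.loss (p : Path N S A d T) (φ : Features N S A d) (βk : ℝ) (k : ℕ) (m : Fin N)
    (θ : EuclideanSpace ℝ (Fin d)) : ℝ :=
  ∑ x : Sample S A m, p.sigma φ k m x *
    (inner ℝ (θ - p.θ k m) (φ m x) - p.Qhat k m x / βk) ^ 2

/-- The approximation error `√(min_{θ ∈ Θ} L(θ))` of the policy class. -/
def Path.approxErr (p : Path N S A d T) (φ : Features N S A d) (R βk : ℝ) (k : ℕ) (m : Fin N) :
    ℝ :=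
  √(sInf (p.loss φ βk k m '' Metric.closedBall 0 R))

/-- The root of the expectation of `L(θ_{k+1}^m)` over the `T` independent samples from `σ_k` that
the inner solver uses, everything before these samples being fixed. -/
def Path.rmsErr (p : Path N S A d T) (φ : Features N S A d) (R G βk : ℝ) (k : ℕ) (m : Fin N) : ℝ :=
  √(∑ x : Fin T → Sample S A m, (∏ t, p.sigma φ k m (x t)) *
      p.loss φ βk k m (p.solve φ R G βk k m x))

/-- The `L²(σ_k)`-error of the estimate of `Q^{1:m}_{π_{θ_k}}`. -/
def Path.evalErr (p : Path N S A d T) (M : MarkovGame N S A) (φ : Features N S A d) (k : ℕ)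
    (m : Fin N) : ℝ :=
  √(∑ x : Sample S A m, p.sigma φ k m x *
    (p.Qhat k m x -
      Qpre M (p.policy φ k) (m + 1) m.isLt x.1 (Fin.snoc (α := fun _ => A) x.2.1 x.2.2)) ^ 2)

/-- The concentrability coefficient of the first `j` agents in iteration `k`, with respect to the
comparison policy `πs` and its stationary state distribution `νs`. -/
def Path.concK (p : Path N S A d T) (φ : Features N S A d) (νs : S → ℝ) (πs : JointPolicy N S A)
    (k j : ℕ) (hj : j ≤ N) : ℝ :=
  conc νs πs (p.ν k) (p.policy φ k) j hj

/-- The error term `Δ_k^m`; agent `m` comes after the first `m` agents, so the first `m + 1` agents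
are those up to and including agent `m`. -/
def Path.bigDelta (p : Path N S A d T) (φ : Features N S A d) (νs : S → ℝ) (πs : JointPolicy N S A)
    (βk : ℝ) (ε ξ : ℕ → Fin N → ℝ) (k : ℕ) (m : Fin N) : ℝ :=
  √2 * (p.concK φ νs πs k (m + 1) m.isLt + p.concK φ νs πs k m m.isLt.le) * (ε k m + ξ k m / βk)

/-- The error term `δ_k^m`. -/
def Path.smallDelta (p : Path N S A d T) (φ : Features N S A d) (νs : S → ℝ)
    (πs : JointPolicy N S A) (ε : ℕ → Fin N → ℝ) (k : ℕ) (m : Fin N) : ℝ :=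
  2 * p.concK φ νs πs k m m.isLt.le * ε k m

/-- The sum of `Δ_k^m + δ_k^m` over all agents and iterations. -/
def Path.errSum (p : Path N S A d T) (φ : Features N S A d) (νs : S → ℝ) (πs : JointPolicy N S A)
    (β : ℝ) (K : ℕ) (ε ξ : ℕ → Fin N → ℝ) : ℝ :=
  ∑ m : Fin N, ∑ k ∈ Finset.range K,
    (p.bigDelta φ νs πs (betaK β K) ε ξ k m + p.smallDelta φ νs πs ε k m)

/-- The suboptimality of the output policy, which is `π_{θ_k}` for a uniformly drawn `k < K`,
averaged over `k`. -/
def Path.gap (p : Path N S A d T) (M : MarkovGame N S A) (φ : Features N S A d) (νs : S → ℝ)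
    (πs : JointPolicy N S A) (K : ℕ) : ℝ :=
  J M νs πs - (K : ℝ)⁻¹ * ∑ k ∈ Finset.range K, J M νs (p.policy φ k)

/-- The estimates are bounded by `B` and have evaluation errors at most `ξ`, and the stationary
distribution `νs` is absolutely continuous with respect to each `ν_k` (so that the densities in the
concentrability coefficients exist; the log-linear policies are positive). -/
structure Path.Regular (p : Path N S A d T) (M : MarkovGame N S A) (φ : Features N S A d)
    (νs : S → ℝ) (B : ℝ) (K : ℕ) (ξ : ℕ → Fin N → ℝ) : Prop where
  bounded : ∀ k < K, ∀ m x, |p.Qhat k m x| ≤ B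
  evalErr_le : ∀ k < K, ∀ m, p.evalErr M φ k m ≤ ξ k m
  absCont : ∀ k < K, ∀ s, p.ν k s = 0 → νs s = 0

/-- `p` is a random execution of the algorithm: `H k m` is the information that is available when
agent `m` draws its samples in iteration `k`; it determines `θ_k`, `ν_k` and `Q̂_k^{1:m}`, and given
it the `T` samples are independent with law `σ_k`. -/
structure IsRandomExecution {Ω : Type*} [mΩ : MeasurableSpace Ω] (μ : Measure Ω)
    (M : MarkovGame N S A) (φ : Features N S A d) (R G β : ℝ) (K : ℕ)
    (H : ℕ → Fin N → MeasurableSpace Ω) (p : Ω → Path N S A d T) : Prop where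
  execution : ∀ ω, IsExecution M φ R G β K (p ω)
  le : ∀ k m, H k m ≤ mΩ
  measurable_θ : ∀ k < K, ∀ m, Measurable[H k m] fun ω => (p ω).θ k
  measurable_ν : ∀ k < K, ∀ m, Measurable[H k m] fun ω => (p ω).ν k
  measurable_Qhat : ∀ k < K, ∀ m, Measurable[H k m] fun ω => (p ω).Qhat k m
  measurable_X : ∀ k < K, ∀ m x, MeasurableSet {ω | (p ω).X k m = x}
  law : ∀ k < K, ∀ m (x : Fin T → Sample S A m),
    μ[Set.indicator {ω | (p ω).X k m = x} (fun _ => (1 : ℝ)) | H k m]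
      =ᵐ[μ] fun ω => ∏ t, (p ω).sigma φ k m (x t)

end Algorithm

end MAPPO

end

/-! The outer loop is inexact mirror descent with the entropy regularizer, run by every agent at
every state and action prefix. The inner loop is least squares by projected SGD.

Since `νs` is stationary for `πs`, the performance difference lemma turns `(1 - γ)(J(π_*) - J(π_k))`
into the expectation under `νs` of the difference of the means of `Q_{π_k}` under `π_*` and `π_k`
(`performance_difference`). Replacing `π_k` by `π_*` one agent at a time telescopes this into one
term per agent (`sum_joint_sub_eq`).

For one agent, the new conditional policy is proportional to `p * exp δ`, where `δ = ⟨θ_{k+1} - θ_k,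
φ⟩` approximates `Q̂ / β_k`. `mirror_step` bounds the term by an increment of `E log π_k` under the
comparison policy, a second-order term `2 (B / β_k)²`, and the errors `|δ - Q̂ / β_k|` averaged
under `π_*` and `π_k`. An average under `π_{k+1}` also occurs; it is reduced to `π_k` at the price
of a factor `exp (4R)`, because parameters stay in the ball. Cauchy–Schwarz converts the averages
into `L²(σ_k)` errors times concentrability coefficients (`sum_mul_abs_le_conc`). Over `k` the
increments telescope to at most `log |A|`, because the initial policies are uniform. This is
`gap_bound`; the prescribed `β` balances its terms (`le_of_balanced`).

For random executions, `gap_bound` is applied pathwise with the realized errors and then integrated.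
The coefficient of the root of the loss is fixed before the samples are drawn, so conditional Jensen
for the square root replaces the realized root by the root mean square (`integral_mul_sqrt_le`).

For the inner loop, each SGD iterate is independent of the next sample, so the usual regret argument
applies in expectation. Averaging gives an excess loss of order `T^(-1/2)`, and subadditivity of the
square root gives `T^(-1/4)`. -/

set_option linter.unusedSectionVars false

noncomputable section

namespace MAPPO

/-! ### Factorized policies and the decomposition over agents -/

section Prefixes

variable {N : ℕ} {S A : Type*} [Fintype A]

lemma prefixProb_snoc (π : JointPolicy N S A) (m : Fin N) (s : S) (b : Fin m → A) (a : A) :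
    π.prefixProb (m + 1) m.isLt s (Fin.snoc (α := fun _ => A) b a) =
      π.prefixProb m m.isLt.le s b * π.prob m s b a := by
  unfold JointPolicy.prefixProb
  rw [Fin.prod_univ_castSucc]
  congr 1
  · refine Finset.prod_congr rfl fun i _ => ?_
    have h : pre (Fin.snoc (α := fun _ => A) b a) (i.castSucc : ℕ) i.castSucc.isLt.le
        = pre b i i.isLt.le := by
      funext j
      exact Fin.snoc_castSucc (α := fun _ => A) (x := a) (p := b) (i := Fin.castLE i.isLt.le j)
    rw [h, Fin.snoc_castSucc]
    rfl
  · have h : pre (Fin.snoc (α := fun _ => A) b a) (Fin.last m : ℕ) (Fin.last (m : ℕ)).isLt.le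
        = b := by
      funext j
      exact Fin.snoc_castSucc (α := fun _ => A) (x := a) (p := b) (i := j)
    rw [h, Fin.snoc_last]
    rfl

lemma sum_snoc {n : ℕ} (f : (Fin (n + 1) → A) → ℝ) :
    ∑ b, f b = ∑ b : Fin n → A, ∑ a, f (Fin.snoc (α := fun _ => A) b a) := by
  rw [← Fintype.sum_prod_type', ← (Fin.snocEquiv (fun _ : Fin (n + 1) => A)).sum_comp,
    ← (Equiv.prodComm _ _).sum_comp]
  rfl

lemma prefixProb_nonneg (π : JointPolicy N S A) (j : ℕ) (hj : j ≤ N) (s : S) (b : Fin j → A) :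
    0 ≤ π.prefixProb j hj s b :=
  Finset.prod_nonneg fun _ _ => π.prob_nonneg _ _ _ _

lemma prefixProb_sum (π : JointPolicy N S A) (s : S) :
    ∀ (j : ℕ) (hj : j ≤ N), ∑ b, π.prefixProb j hj s b = 1
  | 0, _ => by simp [JointPolicy.prefixProb]
  | j + 1, hj => by
    rw [sum_snoc, ← prefixProb_sum π s j (Nat.le_of_succ_le hj)]
    refine Finset.sum_congr rfl fun b _ => ?_
    have h (a : A) := prefixProb_snoc π ⟨j, hj⟩ s b a
    simp only [h, ← Finset.mul_sum, π.prob_sum, mul_one]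

lemma joint_nonneg (π : JointPolicy N S A) (s : S) (a : Fin N → A) : 0 ≤ π.joint s a :=
  prefixProb_nonneg _ _ _ _ _

lemma joint_sum (π : JointPolicy N S A) (s : S) : ∑ a, π.joint s a = 1 :=
  prefixProb_sum _ _ _ _

lemma tailProb_zero (π : JointPolicy N S A) (s : S) (a : Fin N → A) :
    π.tailProb 0 s a = π.joint s a := by
  simp [JointPolicy.tailProb, JointPolicy.joint, JointPolicy.prefixProb]

lemma tailProb_last (π : JointPolicy N S A) (s : S) (a : Fin N → A) : π.tailProb N s a = 1 :=
  Finset.prod_eq_one fun i _ => if_neg (by have := i.isLt; omega)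

lemma tailProb_eq_mul (π : JointPolicy N S A) (m : Fin N) (s : S) (a : Fin N → A) :
    π.tailProb m s a = π.prob m s (pre a m m.isLt.le) (a m) * π.tailProb (m + 1) s a := by
  classical
  unfold JointPolicy.tailProb
  rw [← Finset.mul_prod_erase _ _ (Finset.mem_univ m),
    ← Finset.mul_prod_erase Finset.univ (fun i : Fin N => if (m : ℕ) + 1 ≤ i then _ else _)
      (Finset.mem_univ m)]
  simp only [le_refl, if_true, Nat.succ_le_iff, lt_self_iff_false, if_false, one_mul]
  congr 1
  refine Finset.prod_congr rfl fun i hi => ?_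
  have h : (m : ℕ) ≠ i := fun h => (Finset.mem_erase.1 hi).1 (Fin.ext h.symm)
  simp only [le_iff_lt_or_eq, h, or_false]

lemma pre_eq_snoc_iff (m : Fin N) (a : Fin N → A) (b : Fin m → A) (a' : A) :
    pre a (m + 1) m.isLt = Fin.snoc (α := fun _ => A) b a' ↔
      pre a m m.isLt.le = b ∧ a m = a' := by
  constructor
  · intro h
    constructor
    · funext i
      have := congrFun h i.castSucc
      rwa [Fin.snoc_castSucc] at this
    · have := congrFun h (Fin.last m)
      rwa [Fin.snoc_last] at this
  · rintro ⟨rfl, rfl⟩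
    funext i
    refine Fin.lastCases ?_ (fun i => ?_) i
    · rw [Fin.snoc_last]; rfl
    · rw [Fin.snoc_castSucc]; rfl

variable [Fintype S] [DecidableEq S] [DecidableEq A]

/-- The tower property: revealing the action of agent `m` splits its factor off the tail
probability. It makes consecutive terms comparable in the telescoping sum over agents. -/
lemma Qpre_eq_sum (M : MarkovGame N S A) (π : JointPolicy N S A) (m : Fin N) (s : S)
    (b : Fin m → A) :
    Qpre M π m m.isLt.le s b =
      ∑ a, π.prob m s b a * Qpre M π (m + 1) m.isLt s (Fin.snoc (α := fun _ => A) b a) := by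
  unfold Qpre
  simp only [Finset.mul_sum, pre_eq_snoc_iff]
  rw [Finset.sum_comm]
  refine Finset.sum_congr rfl fun a _ => ?_
  by_cases h : pre a m m.isLt.le = b
  · simp only [h, true_and, if_true, mul_ite, mul_zero, Finset.sum_ite_eq, Finset.mem_univ]
    rw [tailProb_eq_mul, h, mul_assoc]
  · simp [h]

lemma Qpre_zero (M : MarkovGame N S A) (π : JointPolicy N S A) (s : S) (b : Fin 0 → A) :
    Qpre M π 0 (Nat.zero_le N) s b = ∑ a, π.joint s a * Q M π s a := by
  unfold Qpre
  refine Finset.sum_congr rfl fun a _ => ?_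
  rw [if_pos (Subsingleton.elim _ _), tailProb_zero]

lemma Qpre_last (M : MarkovGame N S A) (π : JointPolicy N S A) (s : S) (b : Fin N → A) :
    Qpre M π N le_rfl s b = Q M π s b := by
  unfold Qpre
  have h (a : Fin N → A) : pre a N le_rfl = a := rfl
  simp [h, tailProb_last]

/-- The multi-agent advantage decomposition. -/
lemma sum_joint_sub_eq (M : MarkovGame N S A) (π π' : JointPolicy N S A) (s : S) :
    ∑ a, π'.joint s a * Q M π s a - ∑ a, π.joint s a * Q M π s a =
      ∑ m : Fin N, ∑ b : Fin m → A, π'.prefixProb m m.isLt.le s b *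
        ∑ a, (π'.prob m s b a - π.prob m s b a) *
          Qpre M π (m + 1) m.isLt s (Fin.snoc (α := fun _ => A) b a) := by
  -- `F j` is the mean of `Q_π` when the first `j` agents follow `π'` and the others `π`; the claim
  -- is the telescoping of `F N - F 0`. The value 0 for `j > N` never enters.
  set F : ℕ → ℝ := fun j => if hj : j ≤ N then
    ∑ b : Fin j → A, π'.prefixProb j hj s b * Qpre M π j hj s b else 0 with hF
  have h0 : F 0 = ∑ a, π.joint s a * Q M π s a := by
    simp only [hF, Nat.zero_le, dite_true, Qpre_zero, ← Finset.sum_mul, prefixProb_sum, one_mul]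
  have hN : F N = ∑ a, π'.joint s a * Q M π s a := by
    simp only [hF, le_refl, dite_true, Qpre_last]
    rfl
  rw [← h0, ← hN, ← Finset.sum_range_sub, Finset.sum_range]
  refine Finset.sum_congr rfl fun m _ => ?_
  have hm : (m : ℕ) ≤ N := m.isLt.le
  have hm' : (m : ℕ) + 1 ≤ N := m.isLt
  simp only [hF, dif_pos hm, dif_pos hm']
  rw [sum_snoc, ← Finset.sum_sub_distrib]
  refine Finset.sum_congr rfl fun b _ => ?_
  rw [Qpre_eq_sum, Finset.mul_sum, Finset.mul_sum, ← Finset.sum_sub_distrib]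
  refine Finset.sum_congr rfl fun a _ => ?_
  rw [prefixProb_snoc]
  ring

end Prefixes

/-! ### Value functions, the Bellman equation and performance difference -/

section Bellman

variable {N : ℕ} {S A : Type*} [Fintype S] [DecidableEq S] [Fintype A] [DecidableEq A]
  (M : MarkovGame N S A) (π : JointPolicy N S A)

lemma saDist_nonneg {init : S → (Fin N → A) → ℝ} (h : ∀ s a, 0 ≤ init s a) :
    ∀ t s a, 0 ≤ saDist M π init t s a
  | 0 => h
  | t + 1 => fun _ _ => mul_nonneg (Finset.sum_nonneg fun s _ => Finset.sum_nonneg fun a _ =>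
      mul_nonneg (saDist_nonneg h t s a) (M.P_nonneg _ _ _)) (joint_nonneg _ _ _)

lemma saDist_sum (init : S → (Fin N → A) → ℝ) :
    ∀ t, ∑ s, ∑ a, saDist M π init t s a = ∑ s, ∑ a, init s a
  | 0 => rfl
  | t + 1 => by
    rw [← saDist_sum init t]
    simp only [saDist, ← Finset.mul_sum, joint_sum, mul_one]
    rw [Finset.sum_comm]
    refine Finset.sum_congr rfl fun s _ => ?_
    rw [Finset.sum_comm]
    simp only [← Finset.mul_sum, M.P_sum, mul_one]

/-- The recursion peels off the last step, whereas the Bellman equation needs the first step peeled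
off. -/
lemma saDist_succ (init : S → (Fin N → A) → ℝ) :
    ∀ t, saDist M π init (t + 1) = saDist M π (saDist M π init 1) t
  | 0 => rfl
  | t + 1 => by
    conv_lhs => rw [saDist]
    rw [saDist_succ init t]
    rfl

lemma saDist_sum_smul {ι : Type*} (I : Finset ι) (c : ι → ℝ) (f : ι → S → (Fin N → A) → ℝ) :
    ∀ t s a, saDist M π (fun s a => ∑ i ∈ I, c i * f i s a) t s a =
      ∑ i ∈ I, c i * saDist M π (f i) t s a
  | 0 => fun _ _ => rfl
  | t + 1 => fun s' a' => by
    simp only [saDist, saDist_sum_smul I c f t, Finset.sum_mul]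
    rw [Finset.sum_congr rfl fun s _ => Finset.sum_comm, Finset.sum_comm]
    refine Finset.sum_congr rfl fun i _ => ?_
    simp only [Finset.mul_sum, mul_assoc]

/-- The expected reward at time `t` when `(s_0, a_0) = (s, a)`. -/
def rewardAt (s : S) (a : Fin N → A) (t : ℕ) : ℝ :=
  ∑ s', ∑ a', saDist M π (fun s₀ a₀ => if s₀ = s ∧ a₀ = a then 1 else 0) t s' a' * M.r s' a'

lemma rewardAt_nonneg (s : S) (a : Fin N → A) (t : ℕ) : 0 ≤ rewardAt M π s a t :=
  Finset.sum_nonneg fun _ _ => Finset.sum_nonneg fun _ _ => mul_nonneg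
    (saDist_nonneg M π (fun _ _ => by split_ifs <;> norm_num) _ _ _) (M.r_nonneg _ _)

lemma rewardAt_le_one (s : S) (a : Fin N → A) (t : ℕ) : rewardAt M π s a t ≤ 1 := by
  have h : ∑ s₀, ∑ a₀ : Fin N → A, (if s₀ = s ∧ a₀ = a then (1 : ℝ) else 0) = 1 := by
    simp [ite_and]
  rw [← h, ← saDist_sum M π _ t]
  exact Finset.sum_le_sum fun _ _ => Finset.sum_le_sum fun _ _ => mul_le_of_le_one_right
    (saDist_nonneg M π (fun _ _ => by split_ifs <;> norm_num) _ _ _) (M.r_le_one _ _)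

lemma summable_rewardAt (s : S) (a : Fin N → A) :
    Summable fun t => M.γ ^ t * rewardAt M π s a t :=
  (summable_geometric_of_lt_one M.γ_nonneg M.γ_lt_one).of_nonneg_of_le
    (fun t => mul_nonneg (pow_nonneg M.γ_nonneg t) (rewardAt_nonneg M π s a t))
    fun t => mul_le_of_le_one_right (pow_nonneg M.γ_nonneg t) (rewardAt_le_one M π s a t)

lemma Q_eq_tsum (s : S) (a : Fin N → A) :
    Q M π s a = ∑' t, M.γ ^ t * rewardAt M π s a t := rfl

lemma Q_nonneg (s : S) (a : Fin N → A) : 0 ≤ Q M π s a :=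
  tsum_nonneg fun t => mul_nonneg (pow_nonneg M.γ_nonneg t) (rewardAt_nonneg M π s a t)

lemma Q_le (s : S) (a : Fin N → A) : Q M π s a ≤ (1 - M.γ)⁻¹ := by
  rw [← tsum_geometric_of_lt_one M.γ_nonneg M.γ_lt_one]
  exact (summable_rewardAt M π s a).tsum_le_tsum
    (fun t => mul_le_of_le_one_right (pow_nonneg M.γ_nonneg t) (rewardAt_le_one M π s a t))
    (summable_geometric_of_lt_one M.γ_nonneg M.γ_lt_one)

lemma sum_saDist_mul_r (init : S → (Fin N → A) → ℝ) (t : ℕ) :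
    ∑ s, ∑ a, saDist M π init t s a * M.r s a =
      ∑ x : S × (Fin N → A), init x.1 x.2 * rewardAt M π x.1 x.2 t := by
  have h : init = fun s a => ∑ x : S × (Fin N → A),
      init x.1 x.2 * (if s = x.1 ∧ a = x.2 then 1 else 0) := by
    funext s a
    simp [Fintype.sum_prod_type, ite_and]
  conv_lhs => rw [h]
  have h' (s : S) (a : Fin N → A) := saDist_sum_smul M π Finset.univ
    (fun x : S × (Fin N → A) => init x.1 x.2) (fun x s a => if s = x.1 ∧ a = x.2 then 1 else 0) t s a
  simp only [h', Finset.sum_mul]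
  rw [Finset.sum_congr rfl fun s _ => Finset.sum_comm, Finset.sum_comm]
  refine Finset.sum_congr rfl fun x _ => ?_
  simp only [rewardAt, Finset.mul_sum, mul_assoc]

/-- The law at each time is linear in the initial law, so every return is a mixture of the returns
from point masses, which are the values of `Q`. -/
lemma discReturn_eq_sum (init : S → (Fin N → A) → ℝ) :
    discReturn M π init = ∑ s, ∑ a, init s a * Q M π s a := by
  rw [← Fintype.sum_prod_type' (f := fun s a => init s a * Q M π s a)]
  simp only [discReturn, sum_saDist_mul_r, Finset.mul_sum, Q_eq_tsum, ← tsum_mul_left]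
  rw [Summable.tsum_finsetSum]
  · refine Finset.sum_congr rfl fun x _ => tsum_congr fun t => ?_
    ring
  · intro x _
    refine ((summable_rewardAt M π x.1 x.2).mul_left (init x.1 x.2)).congr fun t => ?_
    ring

lemma V_eq_sum (s : S) : V M π s = ∑ a, π.joint s a * Q M π s a := by
  rw [V, discReturn_eq_sum]
  simp [ite_mul, Finset.sum_ite_eq']

/-- The Bellman equation. -/
lemma Q_eq (s : S) (a : Fin N → A) :
    Q M π s a = M.r s a + M.γ * ∑ s', M.P s a s' * V M π s' := by
  rw [Q_eq_tsum, (summable_rewardAt M π s a).tsum_eq_zero_add]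
  congr 1
  · simp [rewardAt, saDist, ite_and]
  · have h (t : ℕ) : M.γ ^ (t + 1) * rewardAt M π s a (t + 1) =
        M.γ * (M.γ ^ t * ∑ s', ∑ a', saDist M π (saDist M π
          (fun s₀ a₀ => if s₀ = s ∧ a₀ = a then 1 else 0) 1) t s' a' * M.r s' a') := by
      rw [rewardAt, saDist_succ]
      ring
    simp only [h, tsum_mul_left]
    congr 1
    have h1 := discReturn_eq_sum M π (saDist M π (fun s₀ a₀ => if s₀ = s ∧ a₀ = a then 1 else 0) 1)
    rw [discReturn] at h1
    rw [h1]
    refine Finset.sum_congr rfl fun s' _ => ?_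
    rw [V_eq_sum, Finset.mul_sum]
    simp [saDist, ite_and, mul_assoc]

lemma V_nonneg (s : S) : 0 ≤ V M π s := by
  rw [V_eq_sum]
  exact Finset.sum_nonneg fun a _ => mul_nonneg (joint_nonneg _ _ _) (Q_nonneg _ _ _ _)

lemma V_le (s : S) : V M π s ≤ (1 - M.γ)⁻¹ := by
  have h : ∑ a, π.joint s a * (1 - M.γ)⁻¹ = (1 - M.γ)⁻¹ := by
    rw [← Finset.sum_mul, joint_sum, one_mul]
  rw [V_eq_sum, ← h]
  exact Finset.sum_le_sum fun a _ => mul_le_mul_of_nonneg_left (Q_le _ _ _ _) (joint_nonneg _ _ _)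

/-- The performance difference lemma, for the stationary state distribution of one policy. -/
lemma performance_difference {π' : JointPolicy N S A} {ν : S → ℝ} (hν : IsStationary M π' ν) :
    (1 - M.γ) * (J M ν π' - J M ν π) =
      ∑ s, ν s * (∑ a, π'.joint s a * Q M π s a - ∑ a, π.joint s a * Q M π s a) := by
  -- By stationarity, the next state has law `ν` again, so one backup of any `W` under `π'` has mean
  -- reward plus `γ E_ν W`. The lemma follows from `W = V_{π'}` and `W = V_π`.
  have key (W : S → ℝ) : ∑ s, ν s * ∑ a, π'.joint s a * (M.r s a + M.γ * ∑ s', M.P s a s' * W s')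
      = ∑ s, ν s * ∑ a, π'.joint s a * M.r s a + M.γ * ∑ s, ν s * W s := by
    have h : ∑ s', ν s' * W s' = ∑ s, ν s * ∑ a, π'.joint s a * ∑ s', M.P s a s' * W s' := by
      conv_lhs => rw [Finset.sum_congr rfl fun s' _ => congrArg (· * W s') (hν.invariant s').symm]
      simp only [Finset.sum_mul, Finset.mul_sum]
      rw [Finset.sum_comm]
      refine Finset.sum_congr rfl fun s _ => ?_
      rw [Finset.sum_comm]
      simp only [mul_assoc]
    rw [h, Finset.mul_sum, ← Finset.sum_add_distrib]
    refine Finset.sum_congr rfl fun s _ => ?_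
    rw [mul_left_comm, ← mul_add, Finset.mul_sum _ _ M.γ, ← Finset.sum_add_distrib]
    congr 1
    refine Finset.sum_congr rfl fun a _ => ?_
    ring
  have h1 : J M ν π' = ∑ s, ν s * ∑ a, π'.joint s a * M.r s a + M.γ * J M ν π' := by
    rw [J, ← key]
    simp only [← Q_eq, ← V_eq_sum]
  have h2 := key (V M π)
  simp only [← Q_eq] at h2
  simp only [mul_sub, Finset.sum_sub_distrib, h2, ← V_eq_sum]
  simp only [J] at h1 ⊢
  linarith

end Bellman

/-! ### Exponential weights and change of measure -/

section MirrorDescent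

variable {A : Type*} [Fintype A]

lemma exp_sum_le_sum_exp {p : A → ℝ} (hp : ∀ a, 0 ≤ p a) (hp1 : ∑ a, p a = 1) (q : A → ℝ) :
    Real.exp (∑ a, p a * q a) ≤ ∑ a, p a * Real.exp (q a) := by
  simpa using convexOn_exp.map_sum_le (t := Finset.univ) (w := p) (p := q) (fun a _ => hp a) hp1
    (fun _ _ => Set.mem_univ _)

/-- A form of Hoeffding's lemma for finite probability distributions. -/
lemma sum_exp_le {p : A → ℝ} (hp : ∀ a, 0 ≤ p a) (hp1 : ∑ a, p a = 1) {q : A → ℝ} {b : ℝ}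
    (hq : ∀ a, |q a| ≤ b) :
    ∑ a, p a * Real.exp (q a) ≤ Real.exp (∑ a, p a * q a + 2 * b ^ 2) := by
  -- Symmetrization with an independent copy: the product of the two exponential moments is a mean
  -- of `cosh`. As `|q a - q a'| ≤ 2b`, it is at most `exp ((2b)² / 2)`; the second moment is then
  -- removed by Jensen.
  have hprod : (∑ a, p a * Real.exp (q a)) * ∑ a, p a * Real.exp (-q a)
      = ∑ a, ∑ a', p a * p a' * Real.cosh (q a - q a') := by
    have h1 : (∑ a, p a * Real.exp (q a)) * ∑ a, p a * Real.exp (-q a)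
        = ∑ a, ∑ a', p a * p a' * Real.exp (q a - q a') := by
      rw [Finset.sum_mul_sum]
      refine Finset.sum_congr rfl fun a _ => Finset.sum_congr rfl fun a' _ => ?_
      rw [sub_eq_add_neg, Real.exp_add]
      ring
    have h2 : (∑ a, p a * Real.exp (q a)) * ∑ a, p a * Real.exp (-q a)
        = ∑ a, ∑ a', p a * p a' * Real.exp (-(q a - q a')) := by
      rw [h1, Finset.sum_comm]
      refine Finset.sum_congr rfl fun a _ => Finset.sum_congr rfl fun a' _ => ?_
      rw [neg_sub, mul_comm (p a')]
    have h3 : ∑ a, ∑ a', p a * p a' * Real.cosh (q a - q a') =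
        (∑ a, ∑ a', p a * p a' * Real.exp (q a - q a') +
          ∑ a, ∑ a', p a * p a' * Real.exp (-(q a - q a'))) / 2 := by
      simp only [Real.cosh_eq, Finset.sum_div, ← Finset.sum_add_distrib]
      refine Finset.sum_congr rfl fun a _ => Finset.sum_congr rfl fun a' _ => ?_
      ring
    rw [h3, ← h1, ← h2]
    ring
  have hcosh : ∑ a, ∑ a', p a * p a' * Real.cosh (q a - q a') ≤ Real.exp (2 * b ^ 2) := by
    have h : ∑ a, ∑ a', p a * p a' * Real.exp (2 * b ^ 2) = Real.exp (2 * b ^ 2) := by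
      simp only [← Finset.sum_mul, ← Finset.mul_sum, hp1, mul_one, one_mul]
    rw [← h]
    refine Finset.sum_le_sum fun a _ => Finset.sum_le_sum fun a' _ =>
      mul_le_mul_of_nonneg_left ?_ (mul_nonneg (hp a) (hp a'))
    refine (Real.cosh_le_exp_half_sq _).trans (Real.exp_le_exp.2 ?_)
    have h1 := abs_le.1 (hq a)
    have h2 := abs_le.1 (hq a')
    nlinarith
  have hneg : Real.exp (-∑ a, p a * q a) ≤ ∑ a, p a * Real.exp (-q a) := by
    simpa using exp_sum_le_sum_exp hp hp1 fun a => -q a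
  have hpos : 0 ≤ ∑ a, p a * Real.exp (q a) :=
    Finset.sum_nonneg fun a _ => mul_nonneg (hp a) (Real.exp_pos _).le
  have h := (mul_le_mul_of_nonneg_left hneg hpos).trans (hprod.le.trans hcosh)
  rw [Real.exp_neg, ← div_eq_mul_inv, div_le_iff₀ (Real.exp_pos _), ← Real.exp_add] at h
  rwa [add_comm]

/-- One step of inexact mirror descent with the entropy regularizer: `p'` is proportional to
`p * exp δ`, where `δ` approximates `q`. -/
lemma mirror_step {p p' ps δ q : A → ℝ} {b c : ℝ} (hp : ∀ a, 0 < p a) (hp1 : ∑ a, p a = 1)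
    (hp' : ∀ a, p' a = p a * Real.exp (δ a) / ∑ a, p a * Real.exp (δ a))
    (hps : ∀ a, 0 ≤ ps a) (hps1 : ∑ a, ps a = 1) (hq : ∀ a, |q a| ≤ b) (hδ : ∀ a, |δ a| ≤ c) :
    ∑ a, (ps a - p a) * q a ≤ ∑ a, ps a * (Real.log (p' a) - Real.log (p a)) + 2 * b ^ 2 +
      (∑ a, ps a * |δ a - q a| + Real.exp (2 * c) * ∑ a, p a * |δ a - q a|) := by
  set Z := ∑ a, p a * Real.exp (δ a) with hZ
  have hZge : Real.exp (-c) ≤ Z := by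
    have h : ∑ a, p a * Real.exp (-c) = Real.exp (-c) := by rw [← Finset.sum_mul, hp1, one_mul]
    rw [← h]
    exact Finset.sum_le_sum fun a _ => mul_le_mul_of_nonneg_left
      (Real.exp_le_exp.2 (abs_le.1 (hδ a)).1) (hp a).le
  have hZpos : 0 < Z := (Real.exp_pos _).trans_le hZge
  have hlog (a : A) : Real.log (p' a) - Real.log (p a) = δ a - Real.log Z := by
    rw [hp', Real.log_div (mul_pos (hp a) (Real.exp_pos _)).ne' hZpos.ne',
      Real.log_mul (hp a).ne' (Real.exp_pos _).ne', Real.log_exp]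
    ring
  have hp'0 (a : A) : 0 ≤ p' a := by
    rw [hp']; exact div_nonneg (mul_nonneg (hp a).le (Real.exp_pos _).le) hZpos.le
  have hp'1 : ∑ a, p' a = 1 := by
    simp only [hp', ← Finset.sum_div]
    exact div_self hZpos.ne'
  -- The samples are drawn from the old policy, so an error under `p'` has to be moved to `p`. The
  -- density is at most `exp c / exp (-c)`.
  have hratio (a : A) : p' a ≤ Real.exp (2 * c) * p a := by
    rw [hp', div_le_iff₀ hZpos]
    have h : Real.exp (δ a) ≤ Real.exp (2 * c) * Z := by
      calc Real.exp (δ a) ≤ Real.exp c := Real.exp_le_exp.2 (abs_le.1 (hδ a)).2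
        _ = Real.exp (2 * c) * Real.exp (-c) := by rw [← Real.exp_add]; ring_nf
        _ ≤ _ := mul_le_mul_of_nonneg_left hZge (Real.exp_pos _).le
    calc p a * Real.exp (δ a) ≤ p a * (Real.exp (2 * c) * Z) := mul_le_mul_of_nonneg_left h (hp a).le
      _ = _ := by ring
  have hlogZ : Real.log Z ≤ ∑ a, p' a * (δ a - q a) + (∑ a, p a * q a + 2 * b ^ 2) := by
    rw [← Real.log_exp (∑ a, p' a * (δ a - q a) + _)]
    refine Real.log_le_log hZpos ?_
    rw [Real.exp_add]
    -- Jensen under `p'`: the normalization `Z` cancels, since `Z * p' a * exp (q a - δ a) = p a *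
    -- exp (q a)`. Thus the error in `log Z` is linear in `δ - q`.
    have h1 : Z * Real.exp (-∑ a, p' a * (δ a - q a)) ≤ ∑ a, p a * Real.exp (q a) := by
      have h := exp_sum_le_sum_exp hp'0 hp'1 fun a => -(δ a - q a)
      simp only [mul_neg, Finset.sum_neg_distrib] at h
      refine (mul_le_mul_of_nonneg_left h hZpos.le).trans_eq ?_
      rw [Finset.mul_sum]
      refine Finset.sum_congr rfl fun a _ => ?_
      rw [hp', neg_sub, Real.exp_sub]
      field_simp
    have h2 := h1.trans (sum_exp_le (fun a => (hp a).le) hp1 hq)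
    rw [Real.exp_neg, ← div_eq_mul_inv, div_le_iff₀ (Real.exp_pos _)] at h2
    rwa [mul_comm]
  have h1 : ∑ a, ps a * (Real.log (p' a) - Real.log (p a)) = ∑ a, ps a * δ a - Real.log Z := by
    simp only [hlog, mul_sub, Finset.sum_sub_distrib, ← Finset.sum_mul, hps1, one_mul]
  have h2 : ∑ a, p' a * (δ a - q a) ≤ Real.exp (2 * c) * ∑ a, p a * |δ a - q a| := by
    rw [Finset.mul_sum]
    refine Finset.sum_le_sum fun a _ => ?_
    rw [← mul_assoc]
    exact (mul_le_mul_of_nonneg_left (le_abs_self _) (hp'0 a)).trans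
      (mul_le_mul_of_nonneg_right (hratio a) (abs_nonneg _))
  have h3 : ∑ a, ps a * q a ≤ ∑ a, ps a * δ a + ∑ a, ps a * |δ a - q a| := by
    rw [← Finset.sum_add_distrib]
    refine Finset.sum_le_sum fun a _ => ?_
    rw [← mul_add]
    exact mul_le_mul_of_nonneg_left (by linarith [neg_abs_le (δ a - q a)]) (hps a)
  simp only [sub_mul, Finset.sum_sub_distrib]
  linarith

/-- The change of measure by Cauchy--Schwarz. -/
lemma sum_mul_abs_le_sqrt_mul_sqrt {ι : Type*} [Fintype ι] {u σ : ι → ℝ} (g : ι → ℝ)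
    (hσ : ∀ i, 0 ≤ σ i) (h : ∀ i, σ i = 0 → u i = 0) :
    ∑ i, u i * |g i| ≤ √(∑ i, σ i * (u i / σ i) ^ 2) * √(∑ i, σ i * g i ^ 2) := by
  have h1 : ∑ i, u i * |g i| = ∑ i, (√(σ i) * (u i / σ i)) * (√(σ i) * |g i|) := by
    refine Finset.sum_congr rfl fun i _ => ?_
    by_cases hi : σ i = 0
    · simp [hi, h i hi]
    · calc u i * |g i| = (√(σ i) * √(σ i)) * (u i / σ i) * |g i| := by
            rw [Real.mul_self_sqrt (hσ i)]; field_simp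
        _ = _ := by ring
  rw [h1]
  refine (Real.sum_mul_le_sqrt_mul_sqrt _ _ _).trans_eq ?_
  simp only [mul_pow, Real.sq_sqrt (hσ _), sq_abs]

end MirrorDescent

/-! ### Log-linear policies -/

section LogLinear

variable {N d : ℕ} {S A : Type*} [Fintype A] [Nonempty A] (φ : Features N S A d)
  (θ θ' : Fin N → EuclideanSpace ℝ (Fin d))

lemma logLinear_prob (m : Fin N) (s : S) (b : Fin m → A) (a : A) :
    (logLinear φ θ).prob m s b a = Real.exp (inner ℝ (φ m (s, b, a)) (θ m)) /
      ∑ a', Real.exp (inner ℝ (φ m (s, b, a')) (θ m)) := rfl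

lemma sum_exp_pos (f : A → ℝ) : 0 < ∑ a, Real.exp (f a) :=
  Finset.sum_pos (fun _ _ => Real.exp_pos _) Finset.univ_nonempty

lemma logLinear_prob_pos (m : Fin N) (s : S) (b : Fin m → A) (a : A) :
    0 < (logLinear φ θ).prob m s b a :=
  div_pos (Real.exp_pos _) (sum_exp_pos _)

/-- A change of parameters is a multiplicative-weights update, in the form that `mirror_step`
requires. -/
lemma logLinear_prob_update (m : Fin N) (s : S) (b : Fin m → A) (a : A) :
    (logLinear φ θ').prob m s b a =
      (logLinear φ θ).prob m s b a * Real.exp (inner ℝ (θ' m - θ m) (φ m (s, b, a))) /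
        ∑ a, (logLinear φ θ).prob m s b a * Real.exp (inner ℝ (θ' m - θ m) (φ m (s, b, a))) := by
  have h (a : A) : (logLinear φ θ).prob m s b a *
      Real.exp (inner ℝ (θ' m - θ m) (φ m (s, b, a))) =
        Real.exp (inner ℝ (φ m (s, b, a)) (θ' m)) /
          ∑ a', Real.exp (inner ℝ (φ m (s, b, a')) (θ m)) := by
    rw [logLinear_prob, div_mul_eq_mul_div, ← Real.exp_add, inner_sub_left,
      real_inner_comm (φ m _) (θ' m), real_inner_comm (φ m _) (θ m), add_sub_cancel]
  simp only [h, ← Finset.sum_div]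
  rw [logLinear_prob, div_div_div_cancel_right₀ (sum_exp_pos _).ne']

lemma logLinear_prob_of_eq_zero {m : Fin N} (h : θ m = 0) (s : S) (b : Fin m → A) (a : A) :
    (logLinear φ θ).prob m s b a = (Fintype.card A : ℝ)⁻¹ := by
  simp [logLinear_prob, h]

lemma logLinear_prob_le_one (m : Fin N) (s : S) (b : Fin m → A) (a : A) :
    (logLinear φ θ).prob m s b a ≤ 1 := by
  rw [← (logLinear φ θ).prob_sum m s b]
  exact Finset.single_le_sum (fun a _ => (logLinear φ θ).prob_nonneg m s b a) (Finset.mem_univ a)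

end LogLinear

/-! ### Projection onto the ball and boundedness of the iterates -/

section Solver

variable {E : Type*} [NormedAddCommGroup E] [InnerProductSpace ℝ E] {X : Type*} {T : ℕ}
  {R η βk : ℝ} {f : X → E} {q : X → ℝ} {θk : E}

lemma norm_projBall_le (hR : 0 ≤ R) (v : E) : ‖projBall R v‖ ≤ R := by
  unfold projBall
  split_ifs with h
  · exact h
  · have hv : 0 < ‖v‖ := hR.trans_lt (not_le.1 h)
    rw [norm_smul, Real.norm_of_nonneg (by positivity), div_mul_cancel₀ _ hv.ne']

lemma norm_projBall_sub_le (hR : 0 ≤ R) (v : E) {u : E} (hu : ‖u‖ ≤ R) :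
    ‖projBall R v - u‖ ^ 2 ≤ ‖v - u‖ ^ 2 := by
  unfold projBall
  split_ifs with h
  · exact le_rfl
  · have h' := not_le.1 h
    have hv : 0 < ‖v‖ := hR.trans_lt h'
    set c := R / ‖v‖ with hc
    have hc0 : 0 ≤ c := by positivity
    have hc1 : c ≤ 1 := (div_le_one hv).2 h'.le
    have hcR : c * ‖v‖ = R := div_mul_cancel₀ _ hv.ne'
    -- With this bound, `‖v - u‖² - ‖c • v - u‖² ≥ (1 - c)² ‖v‖²`.
    have hin : inner ℝ v u ≤ c * ‖v‖ ^ 2 := by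
      calc inner ℝ v u ≤ ‖v‖ * ‖u‖ := real_inner_le_norm _ _
        _ ≤ ‖v‖ * R := mul_le_mul_of_nonneg_left hu hv.le
        _ = _ := by rw [← hcR]; ring
    rw [norm_sub_sq_real, norm_sub_sq_real, norm_smul, Real.norm_of_nonneg hc0,
      real_inner_smul_left]
    nlinarith [mul_nonneg (sub_nonneg.2 hc1) (sub_nonneg.2 hin),
      mul_nonneg (mul_nonneg (sub_nonneg.2 hc1) (sub_nonneg.2 hc1)) (sq_nonneg ‖v‖)]

lemma norm_sgdIter_le (hR : 0 ≤ R) (x : Fin T → X) (t : ℕ) :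
    ‖sgdIter R η βk f q θk x t‖ ≤ R := by
  induction t with
  | zero => simpa [sgdIter] using hR
  | succ t ih =>
    simp only [sgdIter]
    split_ifs with h
    · exact norm_projBall_le hR _
    · exact ih

lemma norm_sgdOut_le (hR : 0 ≤ R) (x : Fin T → X) : ‖sgdOut R η βk f q θk x‖ ≤ R := by
  unfold sgdOut
  rw [norm_smul, norm_inv, Real.norm_natCast]
  have h : ‖∑ t ∈ Finset.Icc 1 T, sgdIter R η βk f q θk x t‖ ≤ T * R := by
    refine (norm_sum_le_of_le _ fun t _ => norm_sgdIter_le hR x t).trans_eq ?_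
    simp
  rcases Nat.eq_zero_or_pos T with rfl | hT
  · simpa using hR
  · rw [inv_mul_le_iff₀ (by positivity)]
    exact h

end Solver

/-! ### Sample laws and concentrability -/

section Samples

variable {N : ℕ} {S A : Type*} [Fintype S] [Fintype A]

lemma sum_sample {m : Fin N} (f : Sample S A m → ℝ) :
    ∑ x, f x = ∑ s, ∑ b, ∑ a, f (s, b, a) := by
  rw [Fintype.sum_prod_type]
  exact Finset.sum_congr rfl fun s _ => Fintype.sum_prod_type _

lemma sampleProb_nonneg {ν : S → ℝ} (hν : ∀ s, 0 ≤ ν s) (π : JointPolicy N S A) (m : Fin N)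
    (x : Sample S A m) : 0 ≤ sampleProb ν π m x :=
  mul_nonneg (mul_nonneg (hν _) (prefixProb_nonneg _ _ _ _ _)) (π.prob_nonneg _ _ _ _)

lemma sampleProb_eq (ν : S → ℝ) (π : JointPolicy N S A) (m : Fin N) (s : S) (b : Fin m → A)
    (a : A) : sampleProb ν π m (s, b, a) =
      ν s * π.prefixProb (m + 1) m.isLt s (Fin.snoc (α := fun _ => A) b a) := by
  rw [prefixProb_snoc, ← mul_assoc]
  rfl

lemma sum_prefix {ν : S → ℝ} (hν : ∑ s, ν s = 1) (π : JointPolicy N S A) (m : Fin N) :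
    ∑ s, ∑ b, ν s * π.prefixProb m m.isLt.le s b = 1 := by
  simp only [← Finset.mul_sum, prefixProb_sum, mul_one, hν]

lemma sum_sampleProb {ν : S → ℝ} (hν : ∑ s, ν s = 1) (π : JointPolicy N S A) (m : Fin N) :
    ∑ x, sampleProb ν π m x = 1 := by
  rw [sum_sample, ← sum_prefix hν π m]
  simp only [sampleProb, ← Finset.mul_sum, π.prob_sum, mul_one]

variable [DecidableEq S] [DecidableEq A]

lemma conc_nonneg (ν' : S → ℝ) (π' : JointPolicy N S A) (ν : S → ℝ) (π : JointPolicy N S A)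
    (j : ℕ) (hj : j ≤ N) : 0 ≤ conc ν' π' ν π j hj := Real.sqrt_nonneg _

lemma conc_succ_eq (ν' : S → ℝ) (π' : JointPolicy N S A) (ν : S → ℝ) (π : JointPolicy N S A)
    (m : Fin N) : conc ν' π' ν π (m + 1) m.isLt =
      √(∑ x : Sample S A m, sampleProb ν π m x *
        (sampleProb ν' π' m x / sampleProb ν π m x) ^ 2) := by
  simp only [conc, sum_snoc, sum_sample, sampleProb_eq]

/-- If agent `m` follows the same positive factor `π^m` under both laws, that factor cancels in the
density. The coefficient of the first `m` agents is therefore also an `L²` norm over the samples of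
agent `m`. -/
lemma conc_eq_mixed (ν' : S → ℝ) (π' : JointPolicy N S A) (ν : S → ℝ) (π : JointPolicy N S A)
    (hπ : ∀ m s b a, 0 < π.prob m s b a) (m : Fin N) : conc ν' π' ν π m m.isLt.le =
      √(∑ x : Sample S A m, sampleProb ν π m x *
        (ν' x.1 * π'.prefixProb m m.isLt.le x.1 x.2.1 * π.prob m x.1 x.2.1 x.2.2 /
          sampleProb ν π m x) ^ 2) := by
  rw [conc, sum_sample]
  congr 1
  refine Finset.sum_congr rfl fun s _ => Finset.sum_congr rfl fun b _ => ?_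
  conv_lhs => rw [← mul_one (_ * _), ← π.prob_sum m s b, Finset.mul_sum]
  refine Finset.sum_congr rfl fun a _ => ?_
  simp only [sampleProb]
  rw [mul_div_mul_right _ _ (hπ m s b a).ne']
  ring

/-- Expectations of `|g|` under `ν' π'^{1:m}` and under `ν' π'^{1:m-1} π^m` are controlled by the
`L²`-norm of `g` under `ν π^{1:m}` and by the concentrability coefficients. -/
lemma sum_mul_abs_le_conc {ν ν' : S → ℝ} (hν : ∀ s, 0 ≤ ν s) (h : ∀ s, ν s = 0 → ν' s = 0)
    (π' : JointPolicy N S A) {π : JointPolicy N S A} (hπ : ∀ m s b a, 0 < π.prob m s b a)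
    (m : Fin N) (g : Sample S A m → ℝ) :
    ∑ s, ∑ b, ν' s * π'.prefixProb m m.isLt.le s b * ∑ a, π'.prob m s b a * |g (s, b, a)| ≤
        conc ν' π' ν π (m + 1) m.isLt * √(∑ x, sampleProb ν π m x * g x ^ 2) ∧
      ∑ s, ∑ b, ν' s * π'.prefixProb m m.isLt.le s b * ∑ a, π.prob m s b a * |g (s, b, a)| ≤
        conc ν' π' ν π m m.isLt.le * √(∑ x, sampleProb ν π m x * g x ^ 2) := by
  -- Policy factors are positive, so a sample has probability zero only if its state does.
  have hσ : ∀ x : Sample S A m, sampleProb ν π m x = 0 → ν' x.1 = 0 := by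
    intro x hx
    refine h _ ?_
    have h1 : 0 < π.prefixProb m m.isLt.le x.1 x.2.1 := Finset.prod_pos fun _ _ => hπ _ _ _ _
    simpa [sampleProb, h1.ne', (hπ m x.1 x.2.1 x.2.2).ne'] using hx
  constructor
  · rw [conc_succ_eq]
    refine le_trans (le_of_eq ?_) (sum_mul_abs_le_sqrt_mul_sqrt g
      (sampleProb_nonneg hν π m) fun x hx => ?_)
    · simp only [sum_sample, sampleProb, Finset.mul_sum, mul_assoc]
    · simp [sampleProb, hσ x hx]
  · rw [conc_eq_mixed _ _ _ _ hπ]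
    refine le_trans (le_of_eq ?_) (sum_mul_abs_le_sqrt_mul_sqrt g
      (sampleProb_nonneg hν π m) fun x hx => ?_)
    · simp only [sum_sample, Finset.mul_sum, mul_assoc]
    · simp [hσ x hx]

end Samples

/-! ### The bound for a single execution -/

section PathBound

variable {N d T : ℕ} {S A : Type*} [Fintype S] [DecidableEq S] [Fintype A] [DecidableEq A]
  [Nonempty A]

lemma IsExecution.norm_θ_le {M : MarkovGame N S A} {φ : Features N S A d} {R G β : ℝ} {K : ℕ}
    {p : Path N S A d T} (h : IsExecution M φ R G β K p) (hR : 0 ≤ R) :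
    ∀ k ≤ K, ∀ m, ‖p.θ k m‖ ≤ R
  | 0, _, m => by simpa [h.init m] using hR
  | k + 1, hk, m => by
    rw [h.update k hk m]
    exact norm_sgdOut_le hR _

/-- The root of the error `L(θ_{k+1}^m)` of an execution. -/
def Path.lossRoot (p : Path N S A d T) (φ : Features N S A d) (βk : ℝ) (k : ℕ) (m : Fin N) : ℝ :=
  √(p.loss φ βk k m (p.θ (k + 1) m))

/-- The cross entropy of agent `m` of the comparison policy and of the policy `π_{θ_k}`. -/
def Path.potential (p : Path N S A d T) (φ : Features N S A d) (νs : S → ℝ)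
    (πs : JointPolicy N S A) (m : Fin N) (k : ℕ) : ℝ :=
  ∑ s, ∑ b, νs s * πs.prefixProb m m.isLt.le s b *
    ∑ a, πs.prob m s b a * Real.log ((p.policy φ k).prob m s b a)

variable {M : MarkovGame N S A} {φ : Features N S A d} {R G β B : ℝ} {K : ℕ}
  {p : Path N S A d T} {νs : S → ℝ} {πs : JointPolicy N S A} {ξ : ℕ → Fin N → ℝ}

/-- Logarithms of probabilities are nonpositive, and `θ_0 = 0` makes the initial policy uniform,
with potential exactly `-log |A|`. -/
lemma potential_sub_le (hex : IsExecution M φ R G β K p) (hν : IsStationary M πs νs)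
    (m : Fin N) :
    p.potential φ νs πs m K - p.potential φ νs πs m 0 ≤ Real.log (Fintype.card A) := by
  have hw (s : S) (b : Fin m → A) : 0 ≤ νs s * πs.prefixProb m m.isLt.le s b :=
    mul_nonneg (hν.nonneg s) (prefixProb_nonneg _ _ _ _ _)
  have h1 : p.potential φ νs πs m K ≤ 0 :=
    Finset.sum_nonpos fun s _ => Finset.sum_nonpos fun b _ => mul_nonpos_of_nonneg_of_nonpos
      (hw s b) (Finset.sum_nonpos fun a _ => mul_nonpos_of_nonneg_of_nonpos
        (πs.prob_nonneg _ _ _ _) (Real.log_nonpos (JointPolicy.prob_nonneg _ _ _ _ _)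
          (logLinear_prob_le_one _ _ _ _ _ _)))
  have h2 : p.potential φ νs πs m 0 = -Real.log (Fintype.card A) := by
    simp only [Path.potential, Path.policy, logLinear_prob_of_eq_zero φ _ (hex.init m),
      Real.log_inv, mul_neg, Finset.sum_neg_distrib, ← Finset.sum_mul, πs.prob_sum, one_mul,
      sum_prefix hν.sum_eq_one πs m]
  linarith

/-- `mirror_step` averaged over states and prefixes drawn from `νs` and `πs`. The errors are the
realized ones, so that the result serves both for given upper bounds and for integration over the
samples. -/
lemma agent_step (hR : 0 ≤ R) (hφ : ∀ m x, ‖φ m x‖ ≤ 1) (hβ : 0 < β)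
    (hex : IsExecution M φ R G β K p) (hreg : p.Regular M φ νs B K ξ)
    (hν : IsStationary M πs νs) {k : ℕ} (hk : k < K) (m : Fin N) :
    (∑ s, ∑ b, νs s * πs.prefixProb m m.isLt.le s b *
        ∑ a, (πs.prob m s b a - (p.policy φ k).prob m s b a) *
          Qpre M (p.policy φ k) (m + 1) m.isLt s (Fin.snoc (α := fun _ => A) b a)) / betaK β K ≤
      p.potential φ νs πs m (k + 1) - p.potential φ νs πs m k + 2 * (B / betaK β K) ^ 2 +
        Real.exp (4 * R) * p.bigDelta φ νs πs (betaK β K) (p.lossRoot φ (betaK β K))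
          (p.evalErr M φ) k m := by
  have hβk : 0 < betaK β K :=
    mul_pos hβ (Real.sqrt_pos.2 (Nat.cast_pos.2 (Nat.zero_le k |>.trans_lt hk)))
  set βk := betaK β K
  set π := p.policy φ k with hπ
  set Qt : S → (Fin m → A) → A → ℝ := fun s b a =>
    Qpre M π (m + 1) m.isLt s (Fin.snoc (α := fun _ => A) b a) with hQt
  have hπpos : ∀ m s b a, 0 < π.prob m s b a := fun m s b a => logLinear_prob_pos _ _ _ _ _ _
  have hw (s : S) (b : Fin m → A) : 0 ≤ νs s * πs.prefixProb m m.isLt.le s b :=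
    mul_nonneg (hν.nonneg s) (prefixProb_nonneg _ _ _ _ _)
  -- Two separate errors: `e` is the residual of the inner least squares problem, and `g` is the
  -- error of the estimate of `Q`.
  set e : Sample S A m → ℝ := fun x =>
    inner ℝ (p.θ (k + 1) m - p.θ k m) (φ m x) - p.Qhat k m x / βk with he
  set g : Sample S A m → ℝ := fun x => p.Qhat k m x - Qt x.1 x.2.1 x.2.2 with hg
  have hpt (s : S) (b : Fin m → A) :
      (∑ a, (πs.prob m s b a - π.prob m s b a) * Qt s b a) / βk ≤
        (∑ a, πs.prob m s b a * Real.log ((p.policy φ (k + 1)).prob m s b a) -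
          ∑ a, πs.prob m s b a * Real.log (π.prob m s b a)) + 2 * (B / βk) ^ 2 +
        (∑ a, πs.prob m s b a * |e (s, b, a)| +
          Real.exp (4 * R) * ∑ a, π.prob m s b a * |e (s, b, a)|) +
        (∑ a, πs.prob m s b a * |g (s, b, a)| + ∑ a, π.prob m s b a * |g (s, b, a)|) / βk := by
    -- Here `c = 2 * R`, because `θ_k` and `θ_{k+1}` lie in the ball and the features have norm at
    -- most 1; this is the origin of `exp (4 * R)`.
    have h1 := mirror_step (p := π.prob m s b) (p' := (p.policy φ (k + 1)).prob m s b)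
      (ps := πs.prob m s b) (δ := fun a => inner ℝ (p.θ (k + 1) m - p.θ k m) (φ m (s, b, a)))
      (q := fun a => p.Qhat k m (s, b, a) / βk) (b := B / βk) (c := 2 * R)
      (hπpos m s b) (π.prob_sum m s b) (logLinear_prob_update φ _ _ m s b)
      (πs.prob_nonneg m s b) (πs.prob_sum m s b)
      (fun a => by
        rw [abs_div, abs_of_pos hβk]
        exact div_le_div_of_nonneg_right (hreg.bounded k hk m _) hβk.le)
      (fun a => by
        refine (abs_real_inner_le_norm _ _).trans ((mul_le_of_le_one_right (norm_nonneg _)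
          (hφ _ _)).trans ((norm_sub_le _ _).trans ?_))
        linarith [hex.norm_θ_le hR k hk.le m, hex.norm_θ_le hR (k + 1) hk m])
    have h4 : 2 * (2 * R) = 4 * R := by ring
    rw [h4] at h1
    have h2 : (∑ a, (πs.prob m s b a - π.prob m s b a) * Qt s b a) / βk ≤
        ∑ a, (πs.prob m s b a - π.prob m s b a) * (p.Qhat k m (s, b, a) / βk) +
        (∑ a, πs.prob m s b a * |g (s, b, a)| + ∑ a, π.prob m s b a * |g (s, b, a)|) / βk := by
      rw [← Finset.sum_add_distrib, Finset.sum_div, Finset.sum_div, ← Finset.sum_add_distrib]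
      refine Finset.sum_le_sum fun a _ => ?_
      rw [← mul_div_assoc, ← add_div]
      refine div_le_div_of_nonneg_right ?_ hβk.le
      have h3 : Qt s b a = p.Qhat k m (s, b, a) - g (s, b, a) := by simp [hg]
      rw [h3, mul_sub, ← add_mul, sub_eq_add_neg]
      gcongr
      rw [← mul_neg]
      refine (le_abs_self _).trans ?_
      rw [abs_mul, abs_neg]
      gcongr
      refine (abs_sub _ _).trans_eq ?_
      rw [abs_of_nonneg (πs.prob_nonneg _ _ _ _), abs_of_pos (hπpos _ _ _ _)]
    simp only [mul_sub, Finset.sum_sub_distrib] at h1 h2 ⊢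
    linarith
  have hsum := Finset.sum_le_sum fun s (_ : s ∈ Finset.univ) =>
    Finset.sum_le_sum fun b (_ : b ∈ Finset.univ) => mul_le_mul_of_nonneg_left (hpt s b) (hw s b)
  obtain ⟨c1, c2⟩ := sum_mul_abs_le_conc (hex.stationary k hk).nonneg (hreg.absCont k hk) πs
    hπpos m e
  obtain ⟨c3, c4⟩ := sum_mul_abs_le_conc (hex.stationary k hk).nonneg (hreg.absCont k hk) πs
    hπpos m g
  simp only [mul_add, mul_sub, Finset.sum_add_distrib, Finset.sum_sub_distrib, add_div,
    mul_left_comm _ (Real.exp (4 * R)), ← mul_div_assoc, ← Finset.sum_div, ← Finset.mul_sum] at hsum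
  have hconst : ∑ s, ∑ b : Fin m → A, νs s * πs.prefixProb m m.isLt.le s b * (2 * (B / βk) ^ 2) =
      2 * (B / βk) ^ 2 := by
    simp only [← Finset.sum_mul, sum_prefix hν.sum_eq_one πs m, one_mul]
  rw [hconst] at hsum
  have hl : √(∑ x, sampleProb (p.ν k) π m x * e x ^ 2) = p.lossRoot φ βk k m := rfl
  have hv : √(∑ x, sampleProb (p.ν k) π m x * g x ^ 2) = p.evalErr M φ k m := rfl
  rw [hl] at c1 c2
  rw [hv] at c3 c4
  have hE : 1 ≤ Real.exp (4 * R) := Real.one_le_exp (by positivity)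
  have h2 : 1 ≤ √2 := Real.one_le_sqrt.2 one_le_two
  have hl0 : 0 ≤ p.lossRoot φ βk k m := Real.sqrt_nonneg _
  have hv0 : 0 ≤ p.evalErr M φ k m := Real.sqrt_nonneg _
  have ha0 := conc_nonneg νs πs (p.ν k) π (m + 1) m.isLt
  have hb0 := conc_nonneg νs πs (p.ν k) π m m.isLt.le
  have hfin : conc νs πs (p.ν k) π (m + 1) m.isLt * p.lossRoot φ βk k m +
      Real.exp (4 * R) * (conc νs πs (p.ν k) π m m.isLt.le * p.lossRoot φ βk k m) +
      (conc νs πs (p.ν k) π (m + 1) m.isLt * p.evalErr M φ k m / βk +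
        conc νs πs (p.ν k) π m m.isLt.le * p.evalErr M φ k m / βk) ≤
      Real.exp (4 * R) * p.bigDelta φ νs πs βk (p.lossRoot φ βk) (p.evalErr M φ) k m := by
    have hd : p.bigDelta φ νs πs βk (p.lossRoot φ βk) (p.evalErr M φ) k m =
        √2 * ((conc νs πs (p.ν k) π (m + 1) m.isLt + conc νs πs (p.ν k) π m m.isLt.le) *
          (p.lossRoot φ βk k m + p.evalErr M φ k m / βk)) := mul_assoc _ _ _
    rw [hd, mul_div_assoc, mul_div_assoc]
    set r := p.evalErr M φ k m / βk
    have hr0 : 0 ≤ r := div_nonneg hv0 hβk.le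
    set a := conc νs πs (p.ν k) π (m + 1) m.isLt
    set b := conc νs πs (p.ν k) π m m.isLt.le
    set l := p.lossRoot φ βk k m
    calc a * l + Real.exp (4 * R) * (b * l) + (a * r + b * r)
        ≤ Real.exp (4 * R) * (a * l) + Real.exp (4 * R) * (b * l) +
          Real.exp (4 * R) * (a * r + b * r) := by
          exact add_le_add (add_le_add (le_mul_of_one_le_left (mul_nonneg ha0 hl0) hE) le_rfl)
            (le_mul_of_one_le_left (add_nonneg (mul_nonneg ha0 hr0) (mul_nonneg hb0 hr0)) hE)
      _ = Real.exp (4 * R) * ((a + b) * (l + r)) := by ring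
      _ ≤ _ := mul_le_mul_of_nonneg_left (le_mul_of_one_le_left
          (mul_nonneg (add_nonneg ha0 hb0) (add_nonneg hl0 hr0)) h2) (Real.exp_pos _).le
  refine hsum.trans ?_
  have hc2 := mul_le_mul_of_nonneg_left c2 (Real.exp_pos (4 * R)).le
  have hc3 := div_le_div_of_nonneg_right c3 hβk.le
  have hc4 := div_le_div_of_nonneg_right c4 hβk.le
  simp only [Path.potential]
  linarith

lemma smallDelta_nonneg {ε : ℕ → Fin N → ℝ} {k : ℕ} {m : Fin N} (hε : 0 ≤ ε k m) :
    0 ≤ p.smallDelta φ νs πs ε k m :=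
  mul_nonneg (mul_nonneg zero_le_two (Real.sqrt_nonneg _)) hε

lemma bigDelta_mono {βk : ℝ} (hβk : 0 ≤ βk) {ε ξ ε' ξ' : ℕ → Fin N → ℝ} {k : ℕ} {m : Fin N}
    (hε : ε k m ≤ ε' k m) (hξ : ξ k m ≤ ξ' k m) :
    p.bigDelta φ νs πs βk ε ξ k m ≤ p.bigDelta φ νs πs βk ε' ξ' k m :=
  mul_le_mul_of_nonneg_left (add_le_add hε (div_le_div_of_nonneg_right hξ hβk))
    (mul_nonneg (Real.sqrt_nonneg _) (add_nonneg (Real.sqrt_nonneg _) (Real.sqrt_nonneg _)))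

lemma smallDelta_mono {ε ε' : ℕ → Fin N → ℝ} {k : ℕ} {m : Fin N} (hε : ε k m ≤ ε' k m) :
    p.smallDelta φ νs πs ε k m ≤ p.smallDelta φ νs πs ε' k m :=
  mul_le_mul_of_nonneg_left hε (mul_nonneg zero_le_two (Real.sqrt_nonneg _))

lemma betaK_nonneg (hβ : 0 ≤ β) : 0 ≤ betaK β K := mul_nonneg hβ (Real.sqrt_nonneg _)

lemma errSum_mono (hβ : 0 ≤ β) {ε ξ ε' ξ' : ℕ → Fin N → ℝ} (hε : ∀ k < K, ∀ m, ε k m ≤ ε' k m)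
    (hξ : ∀ k < K, ∀ m, ξ k m ≤ ξ' k m) :
    p.errSum φ νs πs β K ε ξ ≤ p.errSum φ νs πs β K ε' ξ' :=
  Finset.sum_le_sum fun m _ => Finset.sum_le_sum fun k hk => by
    have hk := Finset.mem_range.1 hk
    exact add_le_add (bigDelta_mono (betaK_nonneg hβ) (hε k hk m) (hξ k hk m))
      (smallDelta_mono (hε k hk m))

lemma gap_bound (hR : 0 ≤ R) (hφ : ∀ m x, ‖φ m x‖ ≤ 1) (hβ : 0 < β) (hK : 0 < K)
    (hex : IsExecution M φ R G β K p) (hreg : p.Regular M φ νs B K ξ)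
    (hν : IsStationary M πs νs) :
    (1 - M.γ) * (K * p.gap M φ νs πs K) / betaK β K ≤
      N * Real.log (Fintype.card A) + 2 * (B / betaK β K) ^ 2 * (N * K) +
        Real.exp (4 * R) * p.errSum φ νs πs β K (p.lossRoot φ (betaK β K)) (p.evalErr M φ) := by
  have hK' : (K : ℝ) ≠ 0 := Nat.cast_ne_zero.2 hK.ne'
  have h1 : (1 - M.γ) * (K * p.gap M φ νs πs K) / betaK β K = ∑ m : Fin N, ∑ k ∈ Finset.range K,
      (∑ s, ∑ b, νs s * πs.prefixProb m m.isLt.le s b *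
        ∑ a, (πs.prob m s b a - (p.policy φ k).prob m s b a) *
          Qpre M (p.policy φ k) (m + 1) m.isLt s (Fin.snoc (α := fun _ => A) b a)) /
          betaK β K := by
    rw [Path.gap, mul_sub, ← mul_assoc, mul_inv_cancel₀ hK', one_mul, Finset.sum_comm]
    have h2 : (K : ℝ) * J M νs πs = ∑ k ∈ Finset.range K, J M νs πs := by simp
    rw [h2, ← Finset.sum_sub_distrib, Finset.mul_sum, Finset.sum_div]
    refine Finset.sum_congr rfl fun k _ => ?_
    rw [performance_difference M _ hν, ← Finset.sum_div, Finset.sum_comm]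
    congr 1
    refine Finset.sum_congr rfl fun s _ => ?_
    rw [sum_joint_sub_eq, Finset.mul_sum]
    refine Finset.sum_congr rfl fun m _ => ?_
    rw [Finset.mul_sum]
    exact Finset.sum_congr rfl fun b _ => (mul_assoc _ _ _).symm
  rw [h1]
  have hl0 (k : ℕ) (m : Fin N) : 0 ≤ p.lossRoot φ (betaK β K) k m := Real.sqrt_nonneg _
  have hsum : ∑ m : Fin N, ∑ k ∈ Finset.range K, (p.potential φ νs πs m (k + 1) -
      p.potential φ νs πs m k + 2 * (B / betaK β K) ^ 2 + Real.exp (4 * R) *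
        (p.bigDelta φ νs πs (betaK β K) (p.lossRoot φ (betaK β K)) (p.evalErr M φ) k m +
          p.smallDelta φ νs πs (p.lossRoot φ (betaK β K)) k m)) ≤
      N * Real.log (Fintype.card A) + 2 * (B / betaK β K) ^ 2 * (N * K) +
        Real.exp (4 * R) * p.errSum φ νs πs β K (p.lossRoot φ (betaK β K)) (p.evalErr M φ) := by
    simp only [Finset.sum_add_distrib (s := Finset.range K) (g := fun k => Real.exp (4 * R) * _),
      Finset.sum_add_distrib (s := Finset.range K) (g := fun _ => 2 * (B / betaK β K) ^ 2),
      Finset.sum_range_sub, ← Finset.mul_sum]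
    rw [Finset.sum_add_distrib, Finset.sum_add_distrib, ← Finset.mul_sum]
    refine add_le_add (add_le_add ?_ (le_of_eq ?_)) (Finset.mul_sum _ _ _).symm.le
    · refine (Finset.sum_le_sum fun m _ => potential_sub_le hex hν m).trans_eq ?_
      simp
    · simp only [Finset.sum_const, Finset.card_range, Finset.card_univ, Fintype.card_fin,
        nsmul_eq_mul]
      ring
  refine (Finset.sum_le_sum fun m _ => Finset.sum_le_sum fun k hk => ?_).trans hsum
  refine (agent_step hR hφ hβ hex hreg hν (Finset.mem_range.1 hk) m).trans ?_
  gcongr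
  -- The terms `Δ_k^m` already dominate the errors; the terms `δ_k^m` are added as nonnegative
  -- slack.
  exact le_add_of_nonneg_right (smallDelta_nonneg (hl0 k m))

/-- The choice of `β` that balances the terms of `gap_bound`. -/
lemma le_of_balanced {g D L E c n γ : ℝ} (hγ : γ < 1) (hβ : 0 < β) (hK : 0 < K) (hB : 0 < B)
    (hn : 0 ≤ n) (hL : 0 ≤ L) (hc : 1 ≤ c) (hD : D = L + E)
    (h : (1 - γ) * (K * g) / betaK β K ≤ L + 2 * (B / betaK β K) ^ 2 * (n * K) + c * E)
    (hβD : β = √((n * B ^ 2 / 2) / D)) :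
    g ≤ (c + 4) * (B * √n / (1 - γ) * √(D / K)) := by
  have hK' : (0 : ℝ) < K := Nat.cast_pos.2 hK
  have hsK : 0 < √(K : ℝ) := Real.sqrt_pos.2 hK'
  have hKs : √(K : ℝ) ^ 2 = K := Real.sq_sqrt hK'.le
  -- Roots of negative numbers and quotients by zero are 0 by convention, so `β > 0` forces `D > 0`.
  have hpos : 0 < (n * B ^ 2 / 2) / D := Real.sqrt_pos.1 (hβD ▸ hβ)
  have hDpos : 0 < D := by
    by_contra hneg
    exact absurd hpos (not_lt.2 (div_nonpos_of_nonneg_of_nonpos (by positivity) (not_lt.1 hneg)))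
  have hβ2 : β ^ 2 * D = n * B ^ 2 / 2 := by
    rw [hβD, Real.sq_sqrt hpos.le, div_mul_cancel₀ _ hDpos.ne']
  -- The factors `K` cancel, and `n B² = 2 β² D`; this is the 4 in the constant.
  have h1 : 2 * (B / betaK β K) ^ 2 * (n * K) = 4 * D := by
    rw [betaK, div_pow, mul_pow, hKs]
    field_simp
    linarith
  have h2 : (1 - γ) * (K * g) / betaK β K ≤ (c + 4) * D := by
    rw [h1] at h
    nlinarith [mul_nonneg (sub_nonneg.2 hc) hL]
  have hb : 0 < betaK β K := mul_pos hβ hsK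
  rw [div_le_iff₀ hb] at h2
  have h3 : β * D ≤ B * √n * √D := by
    refine abs_le_of_sq_le_sq' ?_ (by positivity) |>.2
    rw [mul_pow, mul_pow, mul_pow, Real.sq_sqrt hn, Real.sq_sqrt hDpos.le]
    nlinarith [mul_nonneg (mul_nonneg hn (sq_nonneg B)) hDpos.le]
  have h4 : √(D / K) = √D / √K := Real.sqrt_div hDpos.le _
  rw [h4]
  have h5 : (c + 4) * (B * √n / (1 - γ) * (√D / √K)) =
      ((c + 4) * (B * √n * √D) * √K) / ((1 - γ) * K) := by
    have : (1 - γ) ≠ 0 := (sub_pos.2 hγ).ne'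
    have h6 : (1 - γ) * (K : ℝ) = (1 - γ) * √(K : ℝ) ^ 2 := by rw [hKs]
    rw [h6]
    field_simp
  rw [h5, le_div_iff₀ (mul_pos (sub_pos.2 hγ) hK')]
  calc g * ((1 - γ) * K) = (1 - γ) * (K * g) := by ring
    _ ≤ _ := h2
    _ = (c + 4) * (β * D) * √K := by rw [betaK]; ring
    _ ≤ _ := by gcongr

end PathBound

/-! ### Independent samples on a finite space -/

section Resampling

variable {X : Type*} [Fintype X] {T : ℕ} {σ : X → ℝ}

lemma sum_prod_eq_one (hσ : ∑ y, σ y = 1) : ∑ x : Fin T → X, ∏ t, σ (x t) = 1 := by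
  classical
  rw [← Fintype.prod_sum]
  simp [hσ]

lemma prod_update_mul (x : Fin T → X) (t : Fin T) (y : X) :
    (∏ i, σ (Function.update x t y i)) * σ (x t) = (∏ i, σ (x i)) * σ y := by
  classical
  rw [← Finset.mul_prod_erase _ _ (Finset.mem_univ t),
    ← Finset.mul_prod_erase Finset.univ (fun i => σ (x i)) (Finset.mem_univ t),
    Function.update_self, Finset.prod_congr rfl fun i hi =>
      congrArg σ (Function.update_of_ne (Finset.ne_of_mem_erase hi) y x)]
  ring

/-- A coordinate of a product measure that a function ignores can be drawn afresh. -/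
lemma sum_prod_mul_eq (hσ : ∑ y, σ y = 1) (t : Fin T) (F : (Fin T → X) → X → ℝ)
    (hF : ∀ x y z, F (Function.update x t y) z = F x z) :
    ∑ x, (∏ i, σ (x i)) * F x (x t) = ∑ x, (∏ i, σ (x i)) * ∑ y, σ y * F x y := by
  -- Exchanging the fresh draw with coordinate `t` is an involution that preserves the product
  -- weights.
  have hinv : Function.Involutive fun z : (Fin T → X) × X => (Function.update z.1 t z.2, z.1 t) := by
    rintro ⟨x, y⟩
    simp
  calc ∑ x, (∏ i, σ (x i)) * F x (x t)
      = ∑ z : (Fin T → X) × X, (∏ i, σ (z.1 i)) * σ z.2 * F z.1 (z.1 t) := by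
        rw [Fintype.sum_prod_type]
        refine Finset.sum_congr rfl fun x _ => ?_
        simp only [← Finset.sum_mul, ← Finset.mul_sum, hσ, mul_one]
    _ = ∑ z : (Fin T → X) × X, (∏ i, σ (z.1 i)) * σ z.2 * F z.1 z.2 := by
        rw [← Equiv.sum_comp hinv.toPerm]
        refine Finset.sum_congr rfl fun z _ => ?_
        simp only [Function.Involutive.coe_toPerm, prod_update_mul, hF, Function.update_self]
    _ = _ := by
        rw [Fintype.sum_prod_type]
        refine Finset.sum_congr rfl fun x _ => ?_
        simp only [Finset.mul_sum, mul_assoc]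

end Resampling

/-! ### Projected SGD for least squares -/

section SGD

variable {E : Type*} [NormedAddCommGroup E] [InnerProductSpace ℝ E] {X : Type*} {T : ℕ}
  {R η βk : ℝ} {f : X → E} {q : X → ℝ} {θk : E}

/-- Iterate `t` uses only samples with index below `t`; this is its independence from sample `t` and
the later ones. -/
lemma sgdIter_update (x : Fin T → X) (j : Fin T) (y : X) :
    ∀ t ≤ (j : ℕ), sgdIter R η βk f q θk (Function.update x j y) t = sgdIter R η βk f q θk x t
  | 0, _ => rfl
  | t + 1, ht => by
    have h : ∀ h : t < T, Function.update x j y ⟨t, h⟩ = x ⟨t, h⟩ := fun h =>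
      Function.update_of_ne (fun h' => by have := congrArg Fin.val h'; simp at this; omega) _ _
    simp only [sgdIter, sgdIter_update x j y t (Nat.le_of_succ_le ht), h]

/-- The residual of the least squares problem of the solver. -/
def residual (βk : ℝ) (f : X → E) (q : X → ℝ) (θk θ : E) (y : X) : ℝ :=
  inner ℝ (θ - θk) (f y) - q y / βk

/-- The objective of the least squares problem of the solver. -/
def sqLoss [Fintype X] (σ : X → ℝ) (βk : ℝ) (f : X → E) (q : X → ℝ) (θk θ : E) : ℝ :=
  ∑ y, σ y * residual βk f q θk θ y ^ 2

lemma residual_sq_le {b : ℝ} (hf : ∀ y, ‖f y‖ ≤ 1) (hq : ∀ y, |q y / βk| ≤ b) (hθk : ‖θk‖ ≤ R)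
    {θ : E} (hθ : ‖θ‖ ≤ R) (y : X) : residual βk f q θk θ y ^ 2 ≤ (2 * R + b) ^ 2 := by
  rw [← sq_abs]
  refine pow_le_pow_left₀ (abs_nonneg _) ?_ 2
  refine (abs_sub _ _).trans (add_le_add ?_ (hq y))
  refine (abs_real_inner_le_norm _ _).trans ((mul_le_of_le_one_right (norm_nonneg _)
    (hf y)).trans ((norm_sub_le _ _).trans ?_))
  linarith

/-- Projection does not increase the distance to `u`. In the expanded square, the cross term
controls the difference of squared residuals by convexity, with surplus `2 η ⟨θ - u, f y⟩²`. -/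
lemma sgd_step {c : ℝ} (hR : 0 ≤ R) (hη : 0 ≤ η) {y : X} (hf : ‖f y‖ ≤ 1) {θ u : E}
    (hu : ‖u‖ ≤ R) (hc : residual βk f q θk θ y ^ 2 ≤ c) :
    ‖projBall R (θ - (2 * η * residual βk f q θk θ y) • f y) - u‖ ^ 2 ≤
      ‖θ - u‖ ^ 2 - 2 * η * (residual βk f q θk θ y ^ 2 - residual βk f q θk u y ^ 2) +
        4 * η ^ 2 * c := by
  refine (norm_projBall_sub_le hR _ hu).trans ?_
  have hru : residual βk f q θk u y = residual βk f q θk θ y - inner ℝ (θ - u) (f y) := by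
    simp only [residual, inner_sub_left]
    ring
  rw [hru]
  set r := residual βk f q θk θ y
  rw [sub_right_comm, norm_sub_sq_real, norm_smul, mul_pow, inner_smul_right, Real.norm_eq_abs,
    sq_abs]
  set i : ℝ := inner ℝ (θ - u) (f y)
  have h1 : (2 * η * r) ^ 2 * ‖f y‖ ^ 2 ≤ 4 * η ^ 2 * c := by
    have hf2 : ‖f y‖ ^ 2 ≤ 1 := pow_le_one₀ (norm_nonneg _) hf
    calc (2 * η * r) ^ 2 * ‖f y‖ ^ 2 ≤ (2 * η * r) ^ 2 * 1 := by gcongr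
      _ = 4 * η ^ 2 * r ^ 2 := by ring
      _ ≤ _ := by gcongr
  nlinarith [mul_nonneg hη (sq_nonneg i)]

lemma residual_sgdOut_sq_le (hT : 0 < T) (x : Fin T → X) (y : X) :
    residual βk f q θk (sgdOut R η βk f q θk x) y ^ 2 ≤
      (T : ℝ)⁻¹ * ∑ t ∈ Finset.Icc 1 T, residual βk f q θk (sgdIter R η βk f q θk x t) y ^ 2 := by
  have hT' : (T : ℝ) ≠ 0 := Nat.cast_ne_zero.2 hT.ne'
  have h : residual βk f q θk (sgdOut R η βk f q θk x) y = (T : ℝ)⁻¹ *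
      ∑ t ∈ Finset.Icc 1 T, residual βk f q θk (sgdIter R η βk f q θk x t) y := by
    simp only [residual, sgdOut, inner_sub_left, real_inner_smul_left, sum_inner,
      Finset.sum_sub_distrib, Finset.sum_const, Nat.card_Icc, add_tsub_cancel_right, nsmul_eq_mul]
    field_simp
  have h2 := sq_sum_le_card_mul_sum_sq (s := Finset.Icc 1 T)
    (f := fun t => residual βk f q θk (sgdIter R η βk f q θk x t) y)
  rw [Nat.card_Icc, add_tsub_cancel_right] at h2
  rw [h, mul_pow]
  refine (mul_le_mul_of_nonneg_left h2 (by positivity)).trans_eq ?_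
  field_simp

variable [Fintype X] {σ : X → ℝ}

lemma sqLoss_nonneg (hσ : ∀ y, 0 ≤ σ y) (θ : E) : 0 ≤ sqLoss σ βk f q θk θ :=
  Finset.sum_nonneg fun y _ => mul_nonneg (hσ y) (sq_nonneg _)

lemma sqLoss_le {b : ℝ} (hσ : ∀ y, 0 ≤ σ y) (hσ1 : ∑ y, σ y = 1) (hf : ∀ y, ‖f y‖ ≤ 1)
    (hq : ∀ y, |q y / βk| ≤ b) (hθk : ‖θk‖ ≤ R) {θ : E} (hθ : ‖θ‖ ≤ R) :
    sqLoss σ βk f q θk θ ≤ (2 * R + b) ^ 2 := by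
  have h : ∑ y, σ y * (2 * R + b) ^ 2 = (2 * R + b) ^ 2 := by rw [← Finset.sum_mul, hσ1, one_mul]
  rw [← h]
  exact Finset.sum_le_sum fun y _ =>
    mul_le_mul_of_nonneg_left (residual_sq_le hf hq hθk hθ y) (hσ y)

lemma sqLoss_sgdOut_le (hT : 0 < T) (hσ : ∀ y, 0 ≤ σ y) (x : Fin T → X) :
    sqLoss σ βk f q θk (sgdOut R η βk f q θk x) ≤
      (T : ℝ)⁻¹ * ∑ t ∈ Finset.Icc 1 T, sqLoss σ βk f q θk (sgdIter R η βk f q θk x t) := by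
  simp only [sqLoss]
  rw [Finset.sum_comm, Finset.mul_sum]
  refine Finset.sum_le_sum fun y _ => ?_
  rw [← Finset.mul_sum, mul_left_comm]
  exact mul_le_mul_of_nonneg_left (residual_sgdOut_sq_le hT x y) (hσ y)

/-- The expected regret of the iterates of projected stochastic gradient descent. -/
lemma sgd_regret {b : ℝ} (hR : 0 ≤ R) (hη : 0 ≤ η) (hσ : ∀ y, 0 ≤ σ y) (hσ1 : ∑ y, σ y = 1)
    (hf : ∀ y, ‖f y‖ ≤ 1) (hq : ∀ y, |q y / βk| ≤ b) (hθk : ‖θk‖ ≤ R) {u : E} (hu : ‖u‖ ≤ R) :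
    2 * η * (∑ x : Fin T → X, (∏ i, σ (x i)) *
      ∑ t ∈ Finset.range T, sqLoss σ βk f q θk (sgdIter R η βk f q θk x t) -
        T * sqLoss σ βk f q θk u) ≤ R ^ 2 + 4 * η ^ 2 * (2 * R + b) ^ 2 * T := by
  set c := (2 * R + b) ^ 2
  set a : ℕ → ℝ := fun t => ∑ x : Fin T → X, (∏ i, σ (x i)) *
    ‖sgdIter R η βk f q θk x t - u‖ ^ 2 with ha
  have hP (x : Fin T → X) : 0 ≤ ∏ i, σ (x i) := Finset.prod_nonneg fun _ _ => hσ _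
  have hP1 : ∑ x : Fin T → X, ∏ i, σ (x i) = 1 := sum_prod_eq_one hσ1
  have hstep (t : ℕ) (ht : t < T) : 2 * η * (∑ x : Fin T → X, (∏ i, σ (x i)) *
      sqLoss σ βk f q θk (sgdIter R η βk f q θk x t) - sqLoss σ βk f q θk u) ≤
        a t - a (t + 1) + 4 * η ^ 2 * c := by
    -- The population loss of iterate `t` may be evaluated at sample `t`, which this iterate has not
    -- seen.
    have h1 : ∑ x : Fin T → X, (∏ i, σ (x i)) *
        sqLoss σ βk f q θk (sgdIter R η βk f q θk x t) = ∑ x : Fin T → X, (∏ i, σ (x i)) *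
          residual βk f q θk (sgdIter R η βk f q θk x t) (x ⟨t, ht⟩) ^ 2 :=
      (sum_prod_mul_eq hσ1 ⟨t, ht⟩
        (fun x y => residual βk f q θk (sgdIter R η βk f q θk x t) y ^ 2) fun x y z => by
          simp only [sgdIter_update x ⟨t, ht⟩ y t le_rfl]).symm
    have h2 : sqLoss σ βk f q θk u = ∑ x : Fin T → X, (∏ i, σ (x i)) *
        residual βk f q θk u (x ⟨t, ht⟩) ^ 2 := by
      rw [sum_prod_mul_eq hσ1 ⟨t, ht⟩ (fun _ y => residual βk f q θk u y ^ 2) fun _ _ _ => rfl,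
        ← Finset.sum_mul, hP1, one_mul]
      rfl
    have h3 : 4 * η ^ 2 * c = ∑ x : Fin T → X, (∏ i, σ (x i)) * (4 * η ^ 2 * c) := by
      rw [← Finset.sum_mul, hP1, one_mul]
    rw [h1, h2, h3, ← Finset.sum_sub_distrib, ← Finset.sum_sub_distrib, ← Finset.sum_add_distrib,
      Finset.mul_sum]
    refine Finset.sum_le_sum fun x _ => ?_
    have h4 := mul_le_mul_of_nonneg_left (sgd_step (θ := sgdIter R η βk f q θk x t) hR hη
      (hf (x ⟨t, ht⟩)) hu (residual_sq_le hf hq hθk (norm_sgdIter_le hR x t) (x ⟨t, ht⟩))) (hP x)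
    have h5 : sgdIter R η βk f q θk x (t + 1) = projBall R (sgdIter R η βk f q θk x t -
        (2 * η * residual βk f q θk (sgdIter R η βk f q θk x t) (x ⟨t, ht⟩)) •
          f (x ⟨t, ht⟩)) := by
      simp only [sgdIter, dif_pos ht, residual]
    rw [h5]
    linarith
  have hsum := Finset.sum_le_sum fun t ht => hstep t (Finset.mem_range.1 ht)
  rw [Finset.sum_add_distrib, Finset.sum_range_sub', ← Finset.mul_sum, Finset.sum_sub_distrib,
    Finset.sum_comm] at hsum
  simp only [← Finset.mul_sum, Finset.sum_const, Finset.card_range, nsmul_eq_mul] at hsum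
  have h0 : a 0 ≤ R ^ 2 := by
    simp only [ha, sgdIter, zero_sub, norm_neg, ← Finset.sum_mul, hP1, one_mul]
    exact pow_le_pow_left₀ (norm_nonneg _) hu 2
  have hTa : 0 ≤ a T := Finset.sum_nonneg fun x _ => mul_nonneg (hP x) (sq_nonneg _)
  linarith

/-- The expected excess loss of the averaged iterate. -/
lemma sgd_excess {b G : ℝ} (hT : 0 < T) (hR : 0 < R) (hG : 0 < G) (hσ : ∀ y, 0 ≤ σ y)
    (hσ1 : ∑ y, σ y = 1) (hf : ∀ y, ‖f y‖ ≤ 1) (hq : ∀ y, |q y / βk| ≤ b) (hθk : ‖θk‖ ≤ R)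
    {u : E} (hu : ‖u‖ ≤ R) :
    ∑ x : Fin T → X, (∏ i, σ (x i)) *
      sqLoss σ βk f q θk (sgdOut R (stepSize R G T) βk f q θk x) ≤ sqLoss σ βk f q θk u +
        (R * G / 2 + 2 * R * (2 * R + b) ^ 2 / G + (2 * R + b) ^ 2) / √(T : ℝ) := by
  have hT' : (0 : ℝ) < T := Nat.cast_pos.2 hT
  have hs : 0 < √(T : ℝ) := Real.sqrt_pos.2 hT'
  have hs2 : √(T : ℝ) ^ 2 = T := Real.sq_sqrt hT'.le
  have hs1 : 1 ≤ √(T : ℝ) := Real.one_le_sqrt.2 (Nat.one_le_cast.2 hT)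
  set η := stepSize R G T with hη
  have hη0 : 0 < η := div_pos hR (mul_pos hG hs)
  set c := (2 * R + b) ^ 2 with hc
  have hc0 : 0 ≤ c := sq_nonneg _
  have hP (x : Fin T → X) : 0 ≤ ∏ i, σ (x i) := Finset.prod_nonneg fun _ _ => hσ _
  have hP1 : ∑ x : Fin T → X, ∏ i, σ (x i) = 1 := sum_prod_eq_one hσ1
  have hreg := sgd_regret (T := T) hR.le hη0.le hσ hσ1 hf hq hθk hu
  set tot := ∑ x : Fin T → X, (∏ i, σ (x i)) *
      ∑ t ∈ Finset.range T, sqLoss σ βk f q θk (sgdIter R η βk f q θk x t) with htot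
  have havg : ∑ x : Fin T → X, (∏ i, σ (x i)) * sqLoss σ βk f q θk (sgdOut R η βk f q θk x) ≤
      (T : ℝ)⁻¹ * (tot + c) := by
    have h : (T : ℝ)⁻¹ * (tot + c) = ∑ x : Fin T → X, (∏ i, σ (x i)) * ((T : ℝ)⁻¹ *
        (∑ t ∈ Finset.range T, sqLoss σ βk f q θk (sgdIter R η βk f q θk x t) + c)) := by
      simp only [mul_left_comm _ (T : ℝ)⁻¹, ← Finset.mul_sum, mul_add (∏ i, _),
        Finset.sum_add_distrib, ← Finset.sum_mul, hP1, one_mul, htot]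
    rw [h]
    refine Finset.sum_le_sum fun x _ => mul_le_mul_of_nonneg_left ?_ (hP x)
    refine (sqLoss_sgdOut_le hT hσ x).trans (mul_le_mul_of_nonneg_left ?_ (by positivity))
    -- The regret concerns `θ(0), …, θ(T-1)`, but the output averages `θ(1), …, θ(T)`. Dropping the
    -- nonnegative loss of `θ(0)` and bounding that of `θ(T)` costs at most `c`.
    have h1 : ∑ t ∈ Finset.Icc 1 T, sqLoss σ βk f q θk (sgdIter R η βk f q θk x t) ≤
        ∑ t ∈ Finset.range (T + 1), sqLoss σ βk f q θk (sgdIter R η βk f q θk x t) :=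
      Finset.sum_le_sum_of_subset_of_nonneg (fun t ht => by simp at ht ⊢; omega)
        fun t _ _ => sqLoss_nonneg hσ _
    rw [Finset.sum_range_succ] at h1
    exact h1.trans (add_le_add le_rfl (sqLoss_le hσ hσ1 hf hq hθk (norm_sgdIter_le hR.le x T)))
  refine havg.trans ?_
  rw [inv_mul_le_iff₀ hT']
  -- With `η = R / (G √T)`, these are `R² / (2η)` and `2 η c T`.
  have h1 : tot - T * sqLoss σ βk f q θk u ≤ R * G / 2 * √T + 2 * R * c / G * √T := by
    refine le_of_mul_le_mul_left (hreg.trans_eq ?_) (mul_pos two_pos hη0)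
    rw [hη, stepSize, ← hs2]
    simp only [Real.sqrt_sq hs.le]
    field_simp
    ring
  have h2 : c ≤ c * √T := le_mul_of_one_le_right hc0 hs1
  have h3 : (T : ℝ) * ((R * G / 2 + 2 * R * c / G + c) / √T) =
      (R * G / 2 + 2 * R * c / G + c) * √T := by
    nth_rw 1 [← hs2]
    field_simp
  rw [mul_add, h3]
  linarith

end SGD

/-! ### Inner-loop error against approximation error -/

section InnerLoop

variable {N d T : ℕ} {S A : Type*} [Fintype S] [DecidableEq S] [Fintype A] [DecidableEq A]
  [Nonempty A] {M : MarkovGame N S A} {φ : Features N S A d} {R G β B : ℝ} {K : ℕ}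
  {p : Path N S A d T}

lemma loss_nonneg {k : ℕ} (hν : ∀ s, 0 ≤ p.ν k s) (βk : ℝ) (m : Fin N)
    (θ : EuclideanSpace ℝ (Fin d)) : 0 ≤ p.loss φ βk k m θ :=
  sqLoss_nonneg (sampleProb_nonneg hν _ m) θ

lemma approxErr_le_rmsErr (hR : 0 ≤ R) {βk : ℝ} {k : ℕ} {m : Fin N}
    (hν : IsStationary M (p.policy φ k) (p.ν k)) :
    p.approxErr φ R βk k m ≤ p.rmsErr φ R G βk k m := by
  refine Real.sqrt_le_sqrt ?_
  have hσ : ∀ y, 0 ≤ p.sigma φ k m y := sampleProb_nonneg hν.nonneg _ m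
  set I := sInf (p.loss φ βk k m '' Metric.closedBall 0 R)
  have h : I = ∑ x : Fin T → Sample S A m, (∏ t, p.sigma φ k m (x t)) * I := by
    rw [← Finset.sum_mul, sum_prod_eq_one (σ := p.sigma φ k m)
      (sum_sampleProb hν.sum_eq_one _ m), one_mul]
  rw [h]
  refine Finset.sum_le_sum fun x _ => mul_le_mul_of_nonneg_left ?_
    (Finset.prod_nonneg fun _ _ => hσ _)
  refine csInf_le ⟨0, ?_⟩ ⟨_, ?_, rfl⟩
  · rintro _ ⟨θ, -, rfl⟩
    exact sqLoss_nonneg hσ θ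
  · rw [mem_closedBall_zero_iff]
    exact norm_sgdOut_le hR x

lemma rmsErr_le_approxErr_add (hT : 0 < T) (hR : 0 < R) (hG : 0 < G)
    (hφ : ∀ m x, ‖φ m x‖ ≤ 1) {βk b : ℝ} {k : ℕ} {m : Fin N}
    (hν : IsStationary M (p.policy φ k) (p.ν k)) (hθ : ‖p.θ k m‖ ≤ R)
    (hq : ∀ x, |p.Qhat k m x / βk| ≤ b) :
    p.rmsErr φ R G βk k m ≤ p.approxErr φ R βk k m +
      √(R * G / 2 + 2 * R * (2 * R + b) ^ 2 / G + (2 * R + b) ^ 2) *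
        (T : ℝ) ^ (-(1 / 4) : ℝ) := by
  have hT' : (0 : ℝ) ≤ T := Nat.cast_nonneg T
  have hσ : ∀ y, 0 ≤ p.sigma φ k m y := sampleProb_nonneg hν.nonneg _ m
  have hσ1 : ∑ y, p.sigma φ k m y = 1 := sum_sampleProb hν.sum_eq_one _ m
  set D := R * G / 2 + 2 * R * (2 * R + b) ^ 2 / G + (2 * R + b) ^ 2 with hD
  have hD0 : 0 ≤ D := by positivity
  have hI0 : 0 ≤ sInf (p.loss φ βk k m '' Metric.closedBall 0 R) :=
    Real.sInf_nonneg (by rintro _ ⟨θ, -, rfl⟩; exact sqLoss_nonneg hσ θ)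
  have h : ∑ x : Fin T → Sample S A m, (∏ t, p.sigma φ k m (x t)) *
      p.loss φ βk k m (p.solve φ R G βk k m x) - D / √(T : ℝ) ≤
        sInf (p.loss φ βk k m '' Metric.closedBall 0 R) := by
    -- The excess bound holds against every `u` in the ball, so it passes to the infimum without a
    -- minimizer.
    refine le_csInf ⟨_, 0, by simpa using hR.le, rfl⟩ ?_
    rintro _ ⟨u, hu, rfl⟩
    rw [sub_le_iff_le_add]
    exact sgd_excess hT hR hG hσ hσ1 (hφ m) hq hθ (mem_closedBall_zero_iff.1 hu)
  have hpow : (T : ℝ) ^ (-(1 / 4) : ℝ) = √(1 / √(T : ℝ)) := by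
    rw [Real.sqrt_div zero_le_one, Real.sqrt_one, Real.sqrt_eq_rpow, Real.sqrt_eq_rpow,
      ← Real.rpow_mul hT', Real.rpow_neg hT', one_div]
    norm_num
  rw [hpow, ← Real.sqrt_mul hD0, mul_one_div]
  refine Real.sqrt_le_iff.2 ⟨add_nonneg (Real.sqrt_nonneg _) (Real.sqrt_nonneg _), ?_⟩
  rw [add_sq, Path.approxErr, Real.sq_sqrt hI0, Real.sq_sqrt (by positivity)]
  have := mul_nonneg (Real.sqrt_nonneg (sInf (p.loss φ βk k m '' Metric.closedBall 0 R)))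
    (Real.sqrt_nonneg (D / √T))
  linarith

end InnerLoop

/-! ### Conditional Jensen for the square root -/

section Conditioning

open scoped ENNReal

variable {Ω : Type*} {m₀ : MeasurableSpace Ω} [mΩ : MeasurableSpace Ω] {μ : Measure Ω}
  [IsProbabilityMeasure μ]

/-- The measures `μ` restricted to `s` and `w μ` agree on `m₀`, which is the defining property of
conditional expectation; hence they integrate `m₀`-measurable functions equally. -/
lemma setLIntegral_eq_of_condExp (hm : m₀ ≤ mΩ) {s : Set Ω} (hs : MeasurableSet s) {w : Ω → ℝ}
    (hw : Measurable[m₀] w) (hw0 : ∀ ω, 0 ≤ w ω)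
    (h : μ[s.indicator (fun _ => (1 : ℝ)) | m₀] =ᵐ[μ] w) {f : Ω → ℝ≥0∞} (hf : Measurable[m₀] f) :
    ∫⁻ ω in s, f ω ∂μ = ∫⁻ ω, ENNReal.ofReal (w ω) * f ω ∂μ := by
  have hwm : Measurable fun ω => ENNReal.ofReal (w ω) := (hw.mono hm le_rfl).ennreal_ofReal
  have hind : Integrable (s.indicator fun _ => (1 : ℝ)) μ := (integrable_const 1).indicator hs
  have hint : Integrable w μ := (integrable_condExp (m := m₀)).congr h
  have hmeas : (μ.restrict s).trim hm = (μ.withDensity fun ω => ENNReal.ofReal (w ω)).trim hm := by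
    refine @Measure.ext _ m₀ _ _ fun A hA => ?_
    rw [trim_measurableSet_eq hm hA, trim_measurableSet_eq hm hA, withDensity_apply _ (hm A hA),
      Measure.restrict_apply (hm A hA)]
    have h1 := setIntegral_condExp hm hind hA
    rw [integral_congr_ae (ae_restrict_of_ae h), integral_indicator hs,
      Measure.restrict_restrict hs, setIntegral_const, smul_eq_mul, mul_one] at h1
    rw [← ofReal_integral_eq_lintegral_ofReal hint.restrict (ae_of_all _ hw0), h1,
      ofReal_measureReal, Set.inter_comm]
  calc ∫⁻ ω in s, f ω ∂μ = ∫⁻ ω, f ω ∂((μ.restrict s).trim hm) := (lintegral_trim hm hf).symm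
    _ = ∫⁻ ω, f ω ∂(μ.withDensity fun ω => ENNReal.ofReal (w ω)) := by
      rw [hmeas, lintegral_trim hm hf]
    _ = _ := lintegral_withDensity_eq_lintegral_mul _ hwm (hf.mono hm le_rfl)

/-- The mean of `c √(g X)` is at most that of `c √(E[g X | m₀])`. -/
lemma lintegral_mul_sqrt_le {ι : Type*} [Fintype ι] (hm : m₀ ≤ mΩ) {X : Ω → ι}
    (hX : ∀ x, MeasurableSet {ω | X ω = x}) {w : ι → Ω → ℝ} (hw : ∀ x, Measurable[m₀] (w x))
    (hw0 : ∀ x ω, 0 ≤ w x ω) (hw1 : ∀ ω, ∑ x, w x ω = 1)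
    (h : ∀ x, μ[Set.indicator {ω | X ω = x} (fun _ => (1 : ℝ)) | m₀] =ᵐ[μ] w x)
    {c : Ω → ℝ} (hc : Measurable[m₀] c) (hc0 : ∀ ω, 0 ≤ c ω) {g : ι → Ω → ℝ}
    (hg : ∀ x, Measurable[m₀] (g x)) (hg0 : ∀ x ω, 0 ≤ g x ω) :
    ∫⁻ ω, ENNReal.ofReal (c ω * √(g (X ω) ω)) ∂μ ≤
      ∫⁻ ω, ENNReal.ofReal (c ω * √(∑ x, w x ω * g x ω)) ∂μ := by
  classical
  have hcg (x : ι) : Measurable[m₀] fun ω => ENNReal.ofReal (c ω * √(g x ω)) :=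
    (hc.mul (hg x).sqrt).ennreal_ofReal
  have h1 : ∫⁻ ω, ENNReal.ofReal (c ω * √(g (X ω) ω)) ∂μ =
      ∑ x, ∫⁻ ω in {ω | X ω = x}, ENNReal.ofReal (c ω * √(g x ω)) ∂μ := by
    rw [Finset.sum_congr rfl fun x _ => (lintegral_indicator (hX x) _).symm, ← lintegral_finsetSum]
    · refine lintegral_congr fun ω => ?_
      rw [Finset.sum_eq_single_of_mem (X ω) (Finset.mem_univ _)]
      · simp
      · intro x _ hx
        simp [hx.symm]
    · exact fun x _ => ((hcg x).mono hm le_rfl).indicator (hX x)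
  have h2 (x : ι) : ∫⁻ ω in {ω | X ω = x}, ENNReal.ofReal (c ω * √(g x ω)) ∂μ =
      ∫⁻ ω, ENNReal.ofReal (w x ω * (c ω * √(g x ω))) ∂μ := by
    rw [setLIntegral_eq_of_condExp hm (hX x) (hw x) (hw0 x) (h x) (hcg x)]
    exact lintegral_congr fun ω => (ENNReal.ofReal_mul (hw0 x ω)).symm
  rw [h1, Finset.sum_congr rfl fun x _ => h2 x, ← lintegral_finsetSum]
  · refine lintegral_mono fun ω => ?_
    rw [← ENNReal.ofReal_sum_of_nonneg fun x _ =>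
      mul_nonneg (hw0 x ω) (mul_nonneg (hc0 ω) (Real.sqrt_nonneg _))]
    refine ENNReal.ofReal_le_ofReal ?_
    -- Jensen for the square root, as Cauchy–Schwarz: `∑ w √g ≤ √(∑ w) √(∑ w g)` with `∑ w = 1`.
    have h3 := Real.sum_mul_le_sqrt_mul_sqrt Finset.univ (fun x => √(w x ω))
      fun x => √(w x ω) * √(g x ω)
    simp only [← mul_assoc, Real.mul_self_sqrt (hw0 _ ω), mul_pow, Real.sq_sqrt (hw0 _ ω),
      Real.sq_sqrt (hg0 _ ω), hw1, Real.sqrt_one, one_mul] at h3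
    simp only [mul_left_comm _ (c ω), ← Finset.mul_sum]
    exact mul_le_mul_of_nonneg_left h3 (hc0 ω)
  · exact fun x _ => (((hw x).mul (hc.mul (hg x).sqrt)).ennreal_ofReal).mono hm le_rfl

/-- Integrability of the left side is part of the conclusion: the comparison of lower integrals
shows that it has finite mean. -/
lemma integral_mul_sqrt_le {ι : Type*} [Fintype ι] (hm : m₀ ≤ mΩ) {X : Ω → ι}
    (hX : ∀ x, MeasurableSet {ω | X ω = x}) {w : ι → Ω → ℝ} (hw : ∀ x, Measurable[m₀] (w x))
    (hw0 : ∀ x ω, 0 ≤ w x ω) (hw1 : ∀ ω, ∑ x, w x ω = 1)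
    (h : ∀ x, μ[Set.indicator {ω | X ω = x} (fun _ => (1 : ℝ)) | m₀] =ᵐ[μ] w x)
    {c : Ω → ℝ} (hc : Measurable[m₀] c) (hc0 : ∀ ω, 0 ≤ c ω) {g : ι → Ω → ℝ}
    (hg : ∀ x, Measurable[m₀] (g x)) (hg0 : ∀ x ω, 0 ≤ g x ω)
    (hint : Integrable (fun ω => c ω * √(∑ x, w x ω * g x ω)) μ) :
    Integrable (fun ω => c ω * √(g (X ω) ω)) μ ∧
      ∫ ω, c ω * √(g (X ω) ω) ∂μ ≤ ∫ ω, c ω * √(∑ x, w x ω * g x ω) ∂μ := by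
  classical
  have hle := lintegral_mul_sqrt_le hm hX hw hw0 hw1 h hc hc0 hg hg0
  have h1 (ω : Ω) : 0 ≤ c ω * √(g (X ω) ω) := mul_nonneg (hc0 ω) (Real.sqrt_nonneg _)
  have h2 (ω : Ω) : 0 ≤ c ω * √(∑ x, w x ω * g x ω) := mul_nonneg (hc0 ω) (Real.sqrt_nonneg _)
  have hfin := hint.lintegral_lt_top
  have hmeas : Measurable fun ω => c ω * √(g (X ω) ω) := by
    have h3 : (fun ω => c ω * √(g (X ω) ω)) = fun ω =>
        ∑ x, Set.indicator {ω | X ω = x} (fun ω => c ω * √(g x ω)) ω := by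
      funext ω
      rw [Finset.sum_eq_single_of_mem (X ω) (Finset.mem_univ _)]
      · simp
      · intro x _ hx
        simp [hx.symm]
    rw [h3]
    exact Finset.measurable_fun_sum _ fun x _ =>
      ((hc.mul (hg x).sqrt).mono hm le_rfl).indicator (hX x)
  refine ⟨⟨hmeas.aestronglyMeasurable, ?_⟩, ?_⟩
  · rw [hasFiniteIntegral_iff_ofReal (ae_of_all _ h1)]
    exact hle.trans_lt hfin
  · rw [integral_eq_lintegral_of_nonneg_ae (ae_of_all _ h1) hmeas.aestronglyMeasurable,
      integral_eq_lintegral_of_nonneg_ae (ae_of_all _ h2) hint.aestronglyMeasurable]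
    exact ENNReal.toReal_mono hfin.ne hle

end Conditioning

/-! ### Measurability of the quantities of an execution -/

section Measurability

variable {Ω : Type*} {mΩ : MeasurableSpace Ω} {N d T : ℕ} {S A : Type*} [Fintype S]
  [DecidableEq S] [Fintype A] [DecidableEq A] [Nonempty A] {M : MarkovGame N S A}
  {φ : Features N S A d} {p : Ω → Path N S A d T} {k : ℕ}

lemma measurable_prob (hθ : Measurable fun ω => (p ω).θ k) (m : Fin N) (s : S) (b : Fin m → A)
    (a : A) : Measurable fun ω => ((p ω).policy φ k).prob m s b a := by
  have h : Measurable fun ω => (p ω).θ k m := (measurable_pi_apply m).comp hθ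
  have h' (a : A) : Measurable fun ω => Real.exp (inner ℝ (φ m (s, b, a)) ((p ω).θ k m)) :=
    (measurable_const.inner h).exp
  exact (h' a).div (Finset.measurable_fun_sum _ fun a _ => h' a)

lemma measurable_prefixProb (hθ : Measurable fun ω => (p ω).θ k) (j : ℕ) (hj : j ≤ N) (s : S)
    (b : Fin j → A) : Measurable fun ω => ((p ω).policy φ k).prefixProb j hj s b :=
  Finset.measurable_fun_prod _ fun _ _ => measurable_prob hθ _ _ _ _

lemma measurable_sigma (hθ : Measurable fun ω => (p ω).θ k) (hν : Measurable fun ω => (p ω).ν k)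
    (m : Fin N) (x : Sample S A m) : Measurable fun ω => (p ω).sigma φ k m x :=
  (((measurable_pi_apply _).comp hν).mul (measurable_prefixProb hθ _ _ _ _)).mul
    (measurable_prob hθ _ _ _ _)

lemma measurable_concK (hθ : Measurable fun ω => (p ω).θ k) (hν : Measurable fun ω => (p ω).ν k)
    (νs : S → ℝ) (πs : JointPolicy N S A) (j : ℕ) (hj : j ≤ N) :
    Measurable fun ω => (p ω).concK φ νs πs k j hj := by
  refine (Finset.measurable_fun_sum _ fun s _ => Finset.measurable_fun_sum _ fun b _ => ?_).sqrt
  have h : Measurable fun ω => (p ω).ν k s * ((p ω).policy φ k).prefixProb j hj s b :=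
    ((measurable_pi_apply s).comp hν).mul (measurable_prefixProb hθ _ _ _ _)
  exact h.mul ((measurable_const.div h).pow_const 2)

lemma measurable_rewardAt (hθ : Measurable fun ω => (p ω).θ k) (s : S) (a : Fin N → A) (t : ℕ) :
    Measurable fun ω => rewardAt M ((p ω).policy φ k) s a t := by
  have h (s' : S) (a' : Fin N → A) : Measurable fun ω => saDist M ((p ω).policy φ k)
      (fun s₀ a₀ => if s₀ = s ∧ a₀ = a then 1 else 0) t s' a' := by
    induction t generalizing s' a' with
    | zero => exact measurable_const
    | succ t ih =>
      exact (Finset.measurable_fun_sum _ fun s _ => Finset.measurable_fun_sum _ fun a _ =>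
        (ih s a).mul_const _).mul (measurable_prefixProb hθ _ _ _ _)
  exact Finset.measurable_fun_sum _ fun s' _ => Finset.measurable_fun_sum _ fun a' _ =>
    (h s' a').mul_const _

lemma measurable_Q (hθ : Measurable fun ω => (p ω).θ k) (s : S) (a : Fin N → A) :
    Measurable fun ω => Q M ((p ω).policy φ k) s a := by
  refine measurable_of_tendsto_metrizable
    (f := fun n ω => ∑ t ∈ Finset.range n, M.γ ^ t * rewardAt M ((p ω).policy φ k) s a t)
    (fun n => Finset.measurable_fun_sum _ fun t _ => (measurable_rewardAt hθ s a t).const_mul _)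
    (tendsto_pi_nhds.2 fun ω => ?_)
  exact (summable_rewardAt M _ s a).hasSum.tendsto_sum_nat

lemma measurable_V (hθ : Measurable fun ω => (p ω).θ k) (s : S) :
    Measurable fun ω => V M ((p ω).policy φ k) s := by
  simp only [V_eq_sum]
  exact Finset.measurable_fun_sum _ fun a _ =>
    (measurable_prefixProb hθ _ _ _ _).mul (measurable_Q hθ s a)

lemma measurable_Qpre (hθ : Measurable fun ω => (p ω).θ k) (j : ℕ) (hj : j ≤ N) (s : S)
    (b : Fin j → A) : Measurable fun ω => Qpre M ((p ω).policy φ k) j hj s b := by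
  refine Finset.measurable_fun_sum _ fun a _ => ?_
  split_ifs
  · refine Measurable.mul (Finset.measurable_fun_prod _ fun i _ => ?_) (measurable_Q hθ s a)
    split_ifs
    · exact measurable_prob hθ _ _ _ _
    · exact measurable_const
  · exact measurable_const

lemma measurable_evalErr (hθ : Measurable fun ω => (p ω).θ k)
    (hν : Measurable fun ω => (p ω).ν k) (m : Fin N)
    (hQ : Measurable fun ω => (p ω).Qhat k m) :
    Measurable fun ω => (p ω).evalErr M φ k m :=
  (Finset.measurable_fun_sum _ fun x _ => (measurable_sigma hθ hν m x).mul
    ((((measurable_pi_apply x).comp hQ).sub (measurable_Qpre hθ _ _ _ _)).pow_const 2)).sqrt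

lemma measurable_projBall {E : Type*} [NormedAddCommGroup E] [InnerProductSpace ℝ E]
    [MeasurableSpace E] [BorelSpace E] [SecondCountableTopology E] (R : ℝ) :
    Measurable (projBall R : E → E) :=
  Measurable.ite (measurableSet_le measurable_norm measurable_const) measurable_id
    ((measurable_const.div measurable_norm).smul measurable_id)

lemma measurable_solve (hθ : Measurable fun ω => (p ω).θ k) (m : Fin N)
    (hQ : Measurable fun ω => (p ω).Qhat k m) (R G βk : ℝ) (x : Fin T → Sample S A m) :
    Measurable fun ω => (p ω).solve φ R G βk k m x := by
  have h : Measurable fun ω => (p ω).θ k m := (measurable_pi_apply m).comp hθ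
  have hit (t : ℕ) : Measurable fun ω => sgdIter R (stepSize R G T) βk (φ m) ((p ω).Qhat k m)
      ((p ω).θ k m) x t := by
    induction t with
    | zero => exact measurable_const
    | succ t ih =>
      simp only [sgdIter]
      split_ifs with ht
      · exact (measurable_projBall R).comp (ih.sub (((((ih.sub h).inner measurable_const).sub
          (((measurable_pi_apply _).comp hQ).div_const βk)).const_mul _).smul_const _))
      · exact ih
  exact (Finset.measurable_fun_sum _ fun t _ => hit t).const_smul (T : ℝ)⁻¹

lemma measurable_loss_solve (hθ : Measurable fun ω => (p ω).θ k)
    (hν : Measurable fun ω => (p ω).ν k) (m : Fin N)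
    (hQ : Measurable fun ω => (p ω).Qhat k m) (R G βk : ℝ) (x : Fin T → Sample S A m) :
    Measurable fun ω => (p ω).loss φ βk k m ((p ω).solve φ R G βk k m x) := by
  have h : Measurable fun ω => (p ω).θ k m := (measurable_pi_apply m).comp hθ
  exact Finset.measurable_fun_sum _ fun y _ => (measurable_sigma hθ hν m y).mul
    (((((measurable_solve hθ m hQ R G βk x).sub h).inner measurable_const).sub
      (((measurable_pi_apply y).comp hQ).div_const βk)).pow_const 2)

lemma measurable_rmsErr (hθ : Measurable fun ω => (p ω).θ k)
    (hν : Measurable fun ω => (p ω).ν k) (m : Fin N)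
    (hQ : Measurable fun ω => (p ω).Qhat k m) (R G βk : ℝ) :
    Measurable fun ω => (p ω).rmsErr φ R G βk k m :=
  (Finset.measurable_fun_sum _ fun x _ => (Finset.measurable_fun_prod _ fun t _ =>
    measurable_sigma hθ hν m (x t)).mul (measurable_loss_solve hθ hν m hQ R G βk x)).sqrt

end Measurability

/-! ### The bound in expectation -/

section RandomExecution

variable {Ω : Type*} [mΩ : MeasurableSpace Ω] {μ : Measure Ω} [IsProbabilityMeasure μ]
  {N d T : ℕ} {S A : Type*} [Fintype S] [DecidableEq S] [Fintype A] [DecidableEq A] [Nonempty A]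
  {M : MarkovGame N S A} {φ : Features N S A d} {R G β B : ℝ} {K : ℕ}
  {H : ℕ → Fin N → MeasurableSpace Ω} {p : Ω → Path N S A d T} {νs : S → ℝ}
  {πs : JointPolicy N S A} {ε ξ : Ω → ℕ → Fin N → ℝ}

lemma integrable_J {k : ℕ} (hθ : Measurable fun ω => (p ω).θ k) :
    Integrable (fun ω => J M νs ((p ω).policy φ k)) μ := by
  refine integrable_finsetSum _ fun s _ => Integrable.const_mul ?_ _
  refine Integrable.of_bound (measurable_V hθ s).aestronglyMeasurable (1 - M.γ)⁻¹
    (ae_of_all _ fun ω => ?_)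
  rw [Real.norm_of_nonneg (V_nonneg _ _ _)]
  exact V_le _ _ _

lemma integrable_gap (hθ : ∀ k < K, Measurable fun ω => (p ω).θ k) :
    Integrable (fun ω => (p ω).gap M φ νs πs K) μ :=
  (integrable_const _).sub ((integrable_finsetSum _ fun k hk =>
    integrable_J (hθ k (Finset.mem_range.1 hk))).const_mul _)

/-- The weight of `ε_k^m` in the sum of the error terms. -/
def Path.errCoeff (q : Path N S A d T) (φ : Features N S A d) (νs : S → ℝ)
    (πs : JointPolicy N S A) (k : ℕ) (m : Fin N) : ℝ :=
  √2 * (q.concK φ νs πs k (m + 1) m.isLt + q.concK φ νs πs k m m.isLt.le) +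
    2 * q.concK φ νs πs k m m.isLt.le

/-- The part of the error terms that is due to the evaluation errors. -/
def Path.evalPart (q : Path N S A d T) (M : MarkovGame N S A) (φ : Features N S A d) (νs : S → ℝ)
    (πs : JointPolicy N S A) (βk : ℝ) (k : ℕ) (m : Fin N) : ℝ :=
  √2 * (q.concK φ νs πs k (m + 1) m.isLt + q.concK φ νs πs k m m.isLt.le) *
    (q.evalErr M φ k m / βk)

lemma errCoeff_nonneg (q : Path N S A d T) (k : ℕ) (m : Fin N) : 0 ≤ q.errCoeff φ νs πs k m :=
  add_nonneg (mul_nonneg (Real.sqrt_nonneg _) (add_nonneg (Real.sqrt_nonneg _)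
    (Real.sqrt_nonneg _))) (mul_nonneg zero_le_two (Real.sqrt_nonneg _))

lemma evalPart_nonneg (q : Path N S A d T) {βk : ℝ} (hβk : 0 ≤ βk) (k : ℕ) (m : Fin N) :
    0 ≤ q.evalPart M φ νs πs βk k m :=
  mul_nonneg (mul_nonneg (Real.sqrt_nonneg _) (add_nonneg (Real.sqrt_nonneg _)
    (Real.sqrt_nonneg _))) (div_nonneg (Real.sqrt_nonneg _) hβk)

lemma errSum_evalErr (q : Path N S A d T) (δ : ℕ → Fin N → ℝ) :
    q.errSum φ νs πs β K δ (q.evalErr M φ) = ∑ m : Fin N, ∑ k ∈ Finset.range K,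
      (q.errCoeff φ νs πs k m * δ k m + q.evalPart M φ νs πs (betaK β K) k m) := by
  refine Finset.sum_congr rfl fun m _ => Finset.sum_congr rfl fun k _ => ?_
  simp only [Path.bigDelta, Path.smallDelta, Path.errCoeff, Path.evalPart]
  ring

/-- The coefficient is random but determined by `H k m`, as is the loss for each fixed value of the
samples. Conditional Jensen thus averages over the samples alone. -/
lemma integral_errCoeff_mul_lossRoot_le (hrand : IsRandomExecution μ M φ R G β K H p) {k : ℕ}
    (hk : k < K) (m : Fin N)
    (hint : Integrable (fun ω => (p ω).errCoeff φ νs πs k m *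
      (p ω).rmsErr φ R G (betaK β K) k m) μ) :
    Integrable (fun ω => (p ω).errCoeff φ νs πs k m * (p ω).lossRoot φ (betaK β K) k m) μ ∧
      ∫ ω, (p ω).errCoeff φ νs πs k m * (p ω).lossRoot φ (betaK β K) k m ∂μ ≤
        ∫ ω, (p ω).errCoeff φ νs πs k m * (p ω).rmsErr φ R G (betaK β K) k m ∂μ := by
  have hθ := hrand.measurable_θ k hk m
  have hν := hrand.measurable_ν k hk m
  have hQ := hrand.measurable_Qhat k hk m
  have hst (ω : Ω) := (hrand.execution ω).stationary k hk
  have hσ (ω : Ω) (x : Sample S A m) : 0 ≤ (p ω).sigma φ k m x :=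
    sampleProb_nonneg (hst ω).nonneg _ m x
  have h := integral_mul_sqrt_le (hrand.le k m) (X := fun ω => (p ω).X k m)
    (hrand.measurable_X k hk m) (w := fun x ω => ∏ t, (p ω).sigma φ k m (x t))
    (fun x => Finset.measurable_fun_prod _ fun t _ => measurable_sigma hθ hν m (x t))
    (fun x ω => Finset.prod_nonneg fun t _ => hσ ω _)
    (fun ω => sum_prod_eq_one (sum_sampleProb (hst ω).sum_eq_one _ m)) (hrand.law k hk m)
    (c := fun ω => (p ω).errCoeff φ νs πs k m)
    ((((measurable_concK hθ hν νs πs _ _).add (measurable_concK hθ hν νs πs _ _)).const_mul _).add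
      ((measurable_concK hθ hν νs πs _ _).const_mul _))
    (fun ω => errCoeff_nonneg _ _ _)
    (g := fun x ω => (p ω).loss φ (betaK β K) k m ((p ω).solve φ R G (betaK β K) k m x))
    (fun x => measurable_loss_solve hθ hν m hQ R G _ x)
    (fun x ω => loss_nonneg (hst ω).nonneg _ _ _) hint
  have hupd (ω : Ω) : (p ω).lossRoot φ (betaK β K) k m =
      √((p ω).loss φ (betaK β K) k m
        ((p ω).solve φ R G (betaK β K) k m ((p ω).X k m))) := by
    rw [Path.lossRoot, (hrand.execution ω).update k hk m]
  simp only [hupd]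
  exact h

lemma integral_errSum_le (hβ : 0 ≤ β) (hrand : IsRandomExecution μ M φ R G β K H p)
    (hreg : ∀ᵐ ω ∂μ, (p ω).Regular M φ νs B K (ξ ω))
    (hε : ∀ᵐ ω ∂μ, ∀ k < K, ∀ m, (p ω).rmsErr φ R G (betaK β K) k m ≤ ε ω k m)
    (hint : Integrable (fun ω => (p ω).errSum φ νs πs β K (ε ω) (ξ ω)) μ) :
    Integrable (fun ω => (p ω).errSum φ νs πs β K ((p ω).lossRoot φ (betaK β K))
        ((p ω).evalErr M φ)) μ ∧
      ∫ ω, (p ω).errSum φ νs πs β K ((p ω).lossRoot φ (betaK β K)) ((p ω).evalErr M φ) ∂μ ≤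
        ∫ ω, (p ω).errSum φ νs πs β K (ε ω) (ξ ω) ∂μ := by
  have hβk : 0 ≤ betaK β K := betaK_nonneg hβ
  have hle : ∀ᵐ ω ∂μ, (p ω).errSum φ νs πs β K ((p ω).rmsErr φ R G (betaK β K))
      ((p ω).evalErr M φ) ≤ (p ω).errSum φ νs πs β K (ε ω) (ξ ω) := by
    filter_upwards [hreg, hε] with ω h1 h2
    exact errSum_mono hβ h2 h1.evalErr_le
  have hcr (ω : Ω) (k : ℕ) (m : Fin N) : 0 ≤ (p ω).errCoeff φ νs πs k m *
      (p ω).rmsErr φ R G (betaK β K) k m :=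
    mul_nonneg (errCoeff_nonneg _ _ _) (Real.sqrt_nonneg _)
  have he (ω : Ω) (k : ℕ) (m : Fin N) : 0 ≤ (p ω).evalPart M φ νs πs (betaK β K) k m :=
    evalPart_nonneg _ hβk _ _
  -- Only the total error is assumed integrable, and `ε`, `ξ` need not be measurable. Each summand
  -- built from `rmsErr` and `evalErr` is measurable, nonnegative and at most the total, hence
  -- integrable.
  have hterm : ∀ᵐ ω ∂μ, ∀ k < K, ∀ m, (p ω).errCoeff φ νs πs k m *
      (p ω).rmsErr φ R G (betaK β K) k m + (p ω).evalPart M φ νs πs (betaK β K) k m ≤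
        (p ω).errSum φ νs πs β K (ε ω) (ξ ω) := by
    filter_upwards [hle] with ω h k hk m
    refine le_trans ?_ h
    rw [errSum_evalErr]
    refine le_trans ?_ (Finset.single_le_sum (fun m _ => Finset.sum_nonneg fun k _ =>
      add_nonneg (hcr ω k m) (he ω k m)) (Finset.mem_univ m))
    exact Finset.single_le_sum (f := fun k => (p ω).errCoeff φ νs πs k m *
      (p ω).rmsErr φ R G (betaK β K) k m + (p ω).evalPart M φ νs πs (betaK β K) k m)
      (fun k _ => add_nonneg (hcr ω k m) (he ω k m)) (Finset.mem_range.2 hk)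
  have hint1 (k : ℕ) (hk : k < K) (m : Fin N) : Integrable (fun ω => (p ω).errCoeff φ νs πs k m *
      (p ω).rmsErr φ R G (betaK β K) k m) μ := by
    have hθ := (hrand.measurable_θ k hk m).mono (hrand.le k m) le_rfl
    have hν := (hrand.measurable_ν k hk m).mono (hrand.le k m) le_rfl
    have hQ := (hrand.measurable_Qhat k hk m).mono (hrand.le k m) le_rfl
    refine hint.mono' (Measurable.aestronglyMeasurable ?_) ?_
    · exact ((((measurable_concK hθ hν νs πs _ _).add
        (measurable_concK hθ hν νs πs _ _)).const_mul _).add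
          ((measurable_concK hθ hν νs πs _ _).const_mul _)).mul (measurable_rmsErr hθ hν m hQ _ _ _)
    · filter_upwards [hterm] with ω h
      rw [Real.norm_of_nonneg (hcr ω k m)]
      linarith [h k hk m, he ω k m]
  have hint2 (k : ℕ) (hk : k < K) (m : Fin N) :
      Integrable (fun ω => (p ω).evalPart M φ νs πs (betaK β K) k m) μ := by
    have hθ := (hrand.measurable_θ k hk m).mono (hrand.le k m) le_rfl
    have hν := (hrand.measurable_ν k hk m).mono (hrand.le k m) le_rfl
    have hQ := (hrand.measurable_Qhat k hk m).mono (hrand.le k m) le_rfl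
    refine hint.mono' (Measurable.aestronglyMeasurable ?_) ?_
    · exact (((measurable_concK hθ hν νs πs _ _).add
        (measurable_concK hθ hν νs πs _ _)).const_mul _).mul
          ((measurable_evalErr hθ hν m hQ).div_const _)
    · filter_upwards [hterm] with ω h
      rw [Real.norm_of_nonneg (he ω k m)]
      linarith [h k hk m, hcr ω k m]
  have hl (k : ℕ) (hk : k < K) (m : Fin N) :=
    integral_errCoeff_mul_lossRoot_le hrand hk m (hint1 k hk m)
  have hl' (k : ℕ) (hk : k < K) (m : Fin N) : Integrable (fun ω => (p ω).errCoeff φ νs πs k m *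
      (p ω).lossRoot φ (betaK β K) k m + (p ω).evalPart M φ νs πs (betaK β K) k m) μ :=
    (hl k hk m).1.add (hint2 k hk m)
  have hr' (k : ℕ) (hk : k < K) (m : Fin N) : Integrable (fun ω => (p ω).errCoeff φ νs πs k m *
      (p ω).rmsErr φ R G (betaK β K) k m + (p ω).evalPart M φ νs πs (betaK β K) k m) μ :=
    (hint1 k hk m).add (hint2 k hk m)
  simp only [errSum_evalErr] at hle ⊢
  refine ⟨integrable_finsetSum _ fun m _ => integrable_finsetSum _ fun k hk =>
    hl' k (Finset.mem_range.1 hk) m, le_trans ?_ (integral_mono_ae (integrable_finsetSum _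
      fun m _ => integrable_finsetSum _ fun k hk => hr' k (Finset.mem_range.1 hk) m) hint hle)⟩
  rw [integral_finsetSum _ fun m _ => integrable_finsetSum _ fun k hk =>
      hl' k (Finset.mem_range.1 hk) m,
    integral_finsetSum _ fun m _ => integrable_finsetSum _ fun k hk =>
      hr' k (Finset.mem_range.1 hk) m]
  refine Finset.sum_le_sum fun m _ => ?_
  rw [integral_finsetSum _ fun k hk => hl' k (Finset.mem_range.1 hk) m,
    integral_finsetSum _ fun k hk => hr' k (Finset.mem_range.1 hk) m]
  refine Finset.sum_le_sum fun k hk => ?_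
  have hk := Finset.mem_range.1 hk
  rw [integral_add (hl k hk m).1 (hint2 k hk m), integral_add (hint1 k hk m) (hint2 k hk m)]
  exact add_le_add (hl k hk m).2 le_rfl

lemma integral_gap_bound (hR : 0 ≤ R) (hφ : ∀ m x, ‖φ m x‖ ≤ 1) (hβ : 0 < β) (hK : 0 < K)
    (hrand : IsRandomExecution μ M φ R G β K H p)
    (hθ : ∀ k < K, Measurable fun ω => (p ω).θ k)
    (hreg : ∀ᵐ ω ∂μ, (p ω).Regular M φ νs B K (ξ ω))
    (hν : IsStationary M πs νs)
    (hε : ∀ᵐ ω ∂μ, ∀ k < K, ∀ m, (p ω).rmsErr φ R G (betaK β K) k m ≤ ε ω k m)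
    (hint : Integrable (fun ω => (p ω).errSum φ νs πs β K (ε ω) (ξ ω)) μ) :
    (1 - M.γ) * (K * ∫ ω, (p ω).gap M φ νs πs K ∂μ) / betaK β K ≤
      N * Real.log (Fintype.card A) + 2 * (B / betaK β K) ^ 2 * (N * K) +
        Real.exp (4 * R) * ∫ ω, (p ω).errSum φ νs πs β K (ε ω) (ξ ω) ∂μ := by
  obtain ⟨hint', hle⟩ := integral_errSum_le hβ.le hrand hreg hε hint
  have hgap : Integrable (fun ω => (p ω).gap M φ νs πs K) μ := integrable_gap hθ
  have h := integral_mono_ae (((hgap.const_mul (K : ℝ)).const_mul (1 - M.γ)).div_const (betaK β K))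
    ((integrable_const (N * Real.log (Fintype.card A) + 2 * (B / betaK β K) ^ 2 * (N * K))).add
      (hint'.const_mul (Real.exp (4 * R)))) (by
        filter_upwards [hreg] with ω hω
        exact gap_bound hR hφ hβ hK (hrand.execution ω) hω hν)
  rw [integral_div, integral_const_mul, integral_const_mul] at h
  refine h.trans ?_
  simp only [Pi.add_apply]
  rw [integral_add (integrable_const _) (hint'.const_mul _), integral_const_mul, integral_const,
    probReal_univ, one_smul]
  gcongr

end RandomExecution

end MAPPO

end

/-! ### Assembly of the three claims -/

theorem theorem1 (R : ℝ) (hR : 0 < R) :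
    ∃ C : ℝ, 0 < C ∧ ∃ C' : ℝ → ℝ → ℝ,
      ∀ (N d K T : ℕ) (_ : 0 < K) (_ : 0 < T)
        (S : Type u) (A : Type v) [Fintype S] [DecidableEq S] [Fintype A] [DecidableEq A]
        [Nonempty A]
        (M : MAPPO.MarkovGame N S A) (φ : MAPPO.Features N S A d) (_ : ∀ m x, ‖φ m x‖ ≤ 1)
        (πs : MAPPO.JointPolicy N S A) (_ : MAPPO.IsOptimal M πs)
        (νs : S → ℝ) (_ : MAPPO.IsStationary M πs νs)
        (B G β : ℝ) (_ : 0 < B) (_ : 0 < G) (_ : 0 < β),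
        -- the bound for every single execution, in terms of its own errors
        (∀ (p : MAPPO.Path N S A d T) (ε ξ : ℕ → Fin N → ℝ),
          MAPPO.IsExecution M φ R G β K p →
          p.Regular M φ νs B K ξ →
          (∀ k < K, ∀ m, 0 ≤ ε k m) →
          (∀ k < K, ∀ m, p.loss φ (MAPPO.betaK β K) k m (p.θ (k + 1) m) ≤ ε k m ^ 2) →
          β = √((N * B ^ 2 / 2) /
            (N * Real.log (Fintype.card A) + p.errSum φ νs πs β K ε ξ)) →
          p.gap M φ νs πs K ≤ C * (B * √(N : ℝ) / (1 - M.γ) *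
            √((N * Real.log (Fintype.card A) + p.errSum φ νs πs β K ε ξ) / K))) ∧
        -- the bound in expectation over the samples, in terms of mean inner-loop errors
        (∀ (Ω : Type w) [MeasurableSpace Ω] (μ : MeasureTheory.Measure Ω)
          [MeasureTheory.IsProbabilityMeasure μ]
          (H : ℕ → Fin N → MeasurableSpace Ω) (p : Ω → MAPPO.Path N S A d T)
          (ε ξ : Ω → ℕ → Fin N → ℝ),
          MAPPO.IsRandomExecution μ M φ R G β K H p →
          (∀ᵐ ω ∂μ, (p ω).Regular M φ νs B K (ξ ω)) →
          (∀ᵐ ω ∂μ, ∀ k < K, ∀ m, (p ω).rmsErr φ R G (MAPPO.betaK β K) k m ≤ ε ω k m) →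
          MeasureTheory.Integrable (fun ω => (p ω).errSum φ νs πs β K (ε ω) (ξ ω)) μ →
          β = √((N * B ^ 2 / 2) / (N * Real.log (Fintype.card A) +
            ∫ ω, (p ω).errSum φ νs πs β K (ε ω) (ξ ω) ∂μ)) →
          MeasureTheory.Integrable (fun ω => (p ω).gap M φ νs πs K) μ ∧
          ∫ ω, (p ω).gap M φ νs πs K ∂μ ≤ C * (B * √(N : ℝ) / (1 - M.γ) *
            √((N * Real.log (Fintype.card A) +
              ∫ ω, (p ω).errSum φ νs πs β K (ε ω) (ξ ω) ∂μ) / K))) ∧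
        -- the mean inner-loop error is the approximation error up to `O(T ^ (-1/4))`
        (∀ p : MAPPO.Path N S A d T,
          MAPPO.IsExecution M φ R G β K p →
          (∀ k < K, ∀ m x, |p.Qhat k m x| ≤ B) →
          ∀ b : ℝ, B / MAPPO.betaK β K ≤ b →
          ∀ k < K, ∀ m,
            p.approxErr φ R (MAPPO.betaK β K) k m ≤ p.rmsErr φ R G (MAPPO.betaK β K) k m ∧
            p.rmsErr φ R G (MAPPO.betaK β K) k m ≤
              p.approxErr φ R (MAPPO.betaK β K) k m + C' G b * (T : ℝ) ^ (-(1 / 4) : ℝ)) := by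
  -- `exp (4R)` multiplies the error terms, and 4 comes from the second-order term at the balanced
  -- `β`. `C'` is the root of the constant in `sgd_excess`.
  refine ⟨Real.exp (4 * R) + 4, by positivity, fun G b =>
    √(R * G / 2 + 2 * R * (2 * R + b) ^ 2 / G + (2 * R + b) ^ 2), ?_⟩
  intro N d K T hK hT S A _ _ _ _ _ M φ hφ πs _ νs hν B G β hB hG hβ
  have hlog : 0 ≤ (N : ℝ) * Real.log (Fintype.card A) :=
    mul_nonneg N.cast_nonneg (Real.log_natCast_nonneg _)
  have hc : 1 ≤ Real.exp (4 * R) := Real.one_le_exp (by positivity)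
  refine ⟨?_, ?_, ?_⟩
  · intro p ε ξ hex hreg hε hloss hβD
    refine MAPPO.le_of_balanced M.γ_lt_one hβ hK hB N.cast_nonneg hlog hc rfl ?_ hβD
    refine (MAPPO.gap_bound hR.le hφ hβ hK hex hreg hν).trans ?_
    have := MAPPO.errSum_mono (p := p) (φ := φ) (νs := νs) (πs := πs) hβ.le
      (fun k hk m => Real.sqrt_le_iff.2 ⟨hε k hk m, hloss k hk m⟩) hreg.evalErr_le
    gcongr
    exact this
  · intro Ω _ μ _ H p ε ξ hrand hreg hε hint hβD
    -- Without agents the prescribed `β` would be 0. An agent is needed because the measurability of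
    -- `θ_k` is stated relative to some `H k m`.
    have hN : 0 < N := by
      refine Nat.pos_of_ne_zero fun hN => hβ.ne' ?_
      rw [hβD]
      subst hN
      simp
    have hθ : ∀ k < K, Measurable fun ω => (p ω).θ k := fun k hk =>
      (hrand.measurable_θ k hk ⟨0, hN⟩).mono (hrand.le _ _) le_rfl
    exact ⟨MAPPO.integrable_gap hθ, MAPPO.le_of_balanced M.γ_lt_one hβ hK hB N.cast_nonneg hlog hc
      rfl (MAPPO.integral_gap_bound hR.le hφ hβ hK hrand hθ hreg hν hε hint) hβD⟩
  · intro p hex hQ b hb k hk m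
    have hβk : 0 < MAPPO.betaK β K := mul_pos hβ (Real.sqrt_pos.2 (Nat.cast_pos.2 hK))
    refine ⟨MAPPO.approxErr_le_rmsErr hR.le (hex.stationary k hk),
      MAPPO.rmsErr_le_approxErr_add hT hR hG hφ (hex.stationary k hk)
        (hex.norm_θ_le hR.le k hk.le m) fun x => ?_⟩
    rw [abs_div, abs_of_pos hβk]
    exact (div_le_div_of_nonneg_right (hQ k hk m x) hβk.le).trans hb
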